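/- Let $(M,g)$ be a smooth Riemannian manifold, and let $M\times S^1$ carry the product metric $g+d\sigma^2$, where $d\sigma^2$ is the standard metric of the unit circle. For an immersed closed curve let $s$ be the arc length, $T$ the unit tangent vector and $\frac{D}{\partial s}$ the covariant derivative along the curve. The curve is called a *ramp* if there is a (smooth) unit tangent vector field $U$ on $S^1$ with $\langle(\pi_{S^1})_*T,U\rangle>0$ along the curve, where $\pi_{S^1}:M\times S^1\to S^1$ is the projection. A *curve shortening flow* on $[0,\tau)$, $0<\tau\le\infty$, is a smooth family of immersed closed curves $\gamma_t=\gamma(\cdot,t):S^1\to M\times S^1$, $t\in[0,\tau)$, with $\frac{\partial\gamma}{\partial t}=\frac{DT}{\partial s}$. A *signed curvature* of the flow is a function $k(\cdot,t)$, continuous on $S^1$ for each $t$, with $\frac{DT}{\partial s}=kN$ for a unit normal field $N$ along $\gamma_t$. Let $\gamma_0:S^1\to M\times S^1$ be a smooth immersed closed curve that is a ramp. Then there are constants $C_1<0$ and $C_2>0$, depending only on $\gamma_0$ (and on $(M,g)$), such that the following holds for every $\Xi>0$ that is an upper bound of the sectional curvature of $M\times S^1$, every $\tau\in(0,\infty]$,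 and every curve shortening flow $(\gamma_t)_{t\in[0,\tau)}$ that starts at $\gamma_0$. The curve $\gamma_t$ is a ramp for every $t\in[0,\tau)$, and for every signed curvature $k$ of the flow: (1) if $\min_{S^1}k(\cdot,t)<0$ for all $t\in[0,\tau)$, then $k(\cdot,t)\ge C_1e^{\Xi t}$ for all $t\in[0,\tau)$; (2) if $\max_{S^1}k(\cdot,t)>0$ for all $t\in[0,\tau)$, then $k(\cdot,t)\le C_2e^{\Xi t}$ for all $t\in[0,\tau)$. -/

import Mathlib

open scoped Manifold ContDiff

noncomputable section

/-! ### Riemannian metrics in linear coordinates -/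

section Coordinates

variable {E : Type*} [NormedAddCommGroup E] [NormedSpace ℝ E]

/-- The covector `z ↦ (∂_v G(w, z) + ∂_w G(v, z) - ∂_z G(v, w)) / 2`
(Christoffel symbols of the first kind) of a metric `G` on (an open part of) `E`. -/
def christoffelFirst (G : E → E →L[ℝ] E →L[ℝ] ℝ) (y v w : E) : E →L[ℝ] ℝ :=
  (1 / 2 : ℝ) • (fderiv ℝ G y v w + fderiv ℝ G y w v - ((fderiv ℝ G y).flip v).flip w)

/-- The Christoffel symbols `Γ_y(v, w)`: the index of `christoffelFirst` is raised with the inverse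
of `G y : E → E*`. -/
def christoffel (G : E → E →L[ℝ] E →L[ℝ] ℝ) (y v w : E) : E :=
  (G y).inverse (christoffelFirst G y v w)

/-- The Riemann curvature `R(a, b)c = ∇_a ∇_b c - ∇_b ∇_a c` of the metric `G` at `y`
(for constant fields `a`, `b`, `c`). -/
def riemannCurvature (G : E → E →L[ℝ] E →L[ℝ] ℝ) (y a b c : E) : E :=
  fderiv ℝ (fun y' => christoffel G y' b c) y a - fderiv ℝ (fun y' => christoffel G y' a c) y b
    + christoffel G y a (christoffel G y b c) - christoffel G y b (christoffel G y a c)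

end Coordinates

/-! ### Riemannian geometry of curves on a manifold -/

section Manifold

variable {E : Type*} [NormedAddCommGroup E] [NormedSpace ℝ E]
  {H : Type*} [TopologicalSpace H] (I : ModelWithCorners ℝ E H)
  {X : Type*} [TopologicalSpace X] [ChartedSpace H X]
  (g : ∀ x : X, TangentSpace I x →L[ℝ] TangentSpace I x →L[ℝ] ℝ)

/-- The metric `g` in the preferred chart around `x`: its pullback by the inverse of the chart. -/
def chartMetric (x : X) (y : E) : E →L[ℝ] E →L[ℝ] ℝ :=
  let p : X := (extChartAt I x).symm y
  let A : E →L[ℝ] E := mfderiv 𝓘(ℝ, E) I (extChartAt I x).symm y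
  let B : E →L[ℝ] E →L[ℝ] ℝ := g p
  B.bilinearComp A A

/-- The sectional curvature of `g` at `x` of the plane spanned by `v` and `w`. -/
def sectionalCurvature (x : X) (v w : TangentSpace I x) : ℝ :=
  let y : E := extChartAt I x x
  let a : E := mfderiv I 𝓘(ℝ, E) (extChartAt I x) x v
  let b : E := mfderiv I 𝓘(ℝ, E) (extChartAt I x) x w
  let G := chartMetric I g x
  G y (riemannCurvature G y a b b) a / (G y a a * G y b b - G y a b ^ 2)

/-- All sectional curvatures of `g` are at most `Ξ`. -/
def SectionalCurvatureLE (Ξ : ℝ) : Prop :=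
  ∀ (x : X) (v w : TangentSpace I x), LinearIndependent ℝ ![v, w] →
    sectionalCurvature I g x v w ≤ Ξ

/-- The velocity `dc/da` of a curve. -/
def velocity (c : ℝ → X) (a : ℝ) : TangentSpace I (c a) :=
  mfderiv 𝓘(ℝ, ℝ) I c a (1 : ℝ)

/-- The speed `|dc/da|`. -/
def speed (c : ℝ → X) (a : ℝ) : ℝ :=
  √(g (c a) (velocity I c a) (velocity I c a))

/-- The unit tangent vector `T`. -/
def unitTangent (c : ℝ → X) (a : ℝ) : TangentSpace I (c a) :=
  (speed I g c a)⁻¹ • velocity I c a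

/-- The (Levi-Civita) covariant derivative `DV/∂a` of a vector field `V` along a curve `c`:
in the preferred chart around `c a` it is `V' + Γ(c', V)`. -/
def covDerivAlong (c : ℝ → X) (V : ∀ a, TangentSpace I (c a)) (a : ℝ) : TangentSpace I (c a) :=
  let y : E := extChartAt I (c a) (c a)
  let c' : E := deriv (fun b => extChartAt I (c a) (c b)) a
  let W : ℝ → E := fun b => mfderiv I 𝓘(ℝ, E) (extChartAt I (c a)) (c b) (V b)
  let D : E := deriv W a + christoffel (chartMetric I g (c a)) y c' (W a)
  (mfderiv 𝓘(ℝ, E) I (extChartAt I (c a)).symm y : E →L[ℝ] E) D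

/-- The curvature vector `DT/∂s`, where `∂/∂s = |dc/da|⁻¹ ∂/∂a`. -/
def curvatureVector (c : ℝ → X) (a : ℝ) : TangentSpace I (c a) :=
  (speed I g c a)⁻¹ • covDerivAlong I g c (unitTangent I g c) a

/-- The parametrization over `ℝ`, by the angle, of a closed curve. -/
def angular (γ : Circle → X) : ℝ → X := fun a => γ (Circle.exp a)

/-- `γ` is a smooth immersed closed curve. -/
def IsImmersedCurve (γ : Circle → X) : Prop :=
  ContMDiff (𝓡 1) I ∞ γ ∧ ∀ a, velocity I (angular γ) a ≠ 0

/-- The time interval `[0, τ)`, where `τ = ⊤` is allowed. -/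
def timeInterval (τ : EReal) : Set ℝ := {t | 0 ≤ t ∧ (t : EReal) < τ}

/-- `γ : S¹ × [0, τ) → X` is a curve shortening flow: a smooth family of immersed closed curves
with `∂γ/∂t = DT/∂s` (at `t = 0` the time derivative is one-sided). -/
structure IsCurveShorteningFlow (τ : EReal) (γ : Circle → ℝ → X) : Prop where
  smooth : ContMDiffOn ((𝓡 1).prod 𝓘(ℝ, ℝ)) I ∞ (Function.uncurry γ)
    (Set.univ ×ˢ timeInterval τ)
  immersed : ∀ t ∈ timeInterval τ, IsImmersedCurve I (fun z => γ z t)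
  evolution : ∀ t ∈ timeInterval τ, ∀ a : ℝ,
    mfderivWithin 𝓘(ℝ, ℝ) I (γ (Circle.exp a)) (timeInterval τ) t (1 : ℝ)
      = curvatureVector I g (angular fun z => γ z t) a

/-- `k` is a signed curvature function of the closed curve `γ`: a continuous function on `S¹` such
that `DT/∂s = k N` for a unit normal field `N` along `γ`. No regularity of `N` is required. -/
def IsSignedCurvature (γ : Circle → X) (k : Circle → ℝ) : Prop :=
  Continuous k ∧ ∃ N : ∀ z : Circle, TangentSpace I (γ z),
    (∀ z, g (γ z) (N z) (N z) = 1) ∧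
    (∀ a : ℝ, g (γ (Circle.exp a)) (N (Circle.exp a)) (unitTangent I g (angular γ) a) = 0) ∧
    ∀ a : ℝ, curvatureVector I g (angular γ) a = k (Circle.exp a) • N (Circle.exp a)

end Manifold

/-! ### The product of a Riemannian manifold with the unit circle -/

/-- The standard metric `dσ²` of the unit circle, induced from `ℂ`. -/
def circleMetric (z : Circle) : TangentSpace (𝓡 1) z →L[ℝ] TangentSpace (𝓡 1) z →L[ℝ] ℝ :=
  let A : EuclideanSpace ℝ (Fin 1) →L[ℝ] ℂ :=
    mfderiv (𝓡 1) 𝓘(ℝ, ℂ) (fun z' : Circle => (z' : ℂ)) z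
  (innerSL ℝ : ℂ →L[ℝ] ℂ →L[ℝ] ℝ).bilinearComp A A

section Product

variable {n : ℕ} {M : Type*} [TopologicalSpace M] [ChartedSpace (EuclideanSpace ℝ (Fin n)) M]

/-- The product metric `g + dσ²` on `M × S¹`. -/
def productMetric (g : ∀ x : M, TangentSpace (𝓡 n) x →L[ℝ] TangentSpace (𝓡 n) x →L[ℝ] ℝ)
    (p : M × Circle) : TangentSpace ((𝓡 n).prod (𝓡 1)) p →L[ℝ]
      TangentSpace ((𝓡 n).prod (𝓡 1)) p →L[ℝ] ℝ :=
  let P : EuclideanSpace ℝ (Fin n) × EuclideanSpace ℝ (Fin 1) →L[ℝ] EuclideanSpace ℝ (Fin n) :=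
    mfderiv ((𝓡 n).prod (𝓡 1)) (𝓡 n) (Prod.fst : M × Circle → M) p
  let Q : EuclideanSpace ℝ (Fin n) × EuclideanSpace ℝ (Fin 1) →L[ℝ] EuclideanSpace ℝ (Fin 1) :=
    mfderiv ((𝓡 n).prod (𝓡 1)) (𝓡 1) (Prod.snd : M × Circle → Circle) p
  let g₁ : EuclideanSpace ℝ (Fin n) →L[ℝ] EuclideanSpace ℝ (Fin n) →L[ℝ] ℝ := g p.1
  let g₂ : EuclideanSpace ℝ (Fin 1) →L[ℝ] EuclideanSpace ℝ (Fin 1) →L[ℝ] ℝ := circleMetric p.2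
  g₁.bilinearComp P P + g₂.bilinearComp Q Q

/-- A closed curve in `(M × S¹, g + dσ²)` is a ramp if there is a smooth unit tangent vector field
`U` on `S¹` with `⟨(π_{S¹})_* T, U⟩ > 0` along the curve. -/
def IsRamp (g : ∀ x : M, TangentSpace (𝓡 n) x →L[ℝ] TangentSpace (𝓡 n) x →L[ℝ] ℝ)
    (γ : Circle → M × Circle) : Prop :=
  ∃ U : ∀ z : Circle, TangentSpace (𝓡 1) z,
    ContMDiff (𝓡 1) (𝓡 1).tangent ∞ (fun z => (⟨z, U z⟩ : TangentBundle (𝓡 1) Circle)) ∧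
    (∀ z, circleMetric z (U z) (U z) = 1) ∧
    ∀ a : ℝ, 0 < circleMetric (angular γ a).2
      (mfderiv ((𝓡 n).prod (𝓡 1)) (𝓡 1) (Prod.snd : M × Circle → Circle) (angular γ a)
        (unitTangent ((𝓡 n).prod (𝓡 1)) (productMetric g) (angular γ) a))
      (U (angular γ a).2)

end Product

end

/-!
The angular form of the circle pulls back to a parallel one-form on `M × S¹`, and `γ` is a ramp if
and only if `θ(T) > 0` for this form or its negative `θ`. Let `u = θ(T)`, `κ = DT/∂s` and
`K = |κ|²`. Along the flow `∂u/∂t = ∂²u/∂s² + K u`, so by the maximum principle `u` stays positive;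
here the angular form being parallel is what removes all curvature terms. Moreover
`∂K/∂t = ∂²K/∂s² - 2 |Dκ/∂s|² + 4 K² + 2 ⟨R(κ, T)T, κ⟩`.
Let `c > Ξ` and choose `B` with `K < B u²` at `t = 0`. At a first zero of `K - B e^{2ct} u²` the
vanishing of its space derivative determines `⟨Dκ/∂s, κ⟩`, while `⟨Dκ/∂s, T⟩ = -K`; Bessel's
inequality for these two components of `Dκ/∂s` makes the quartic and gradient terms cancel and
leaves `0 ≤ 2 (Ξ - c) K`, a contradiction. Letting `c → Ξ` and using `u² ≤ 1` gives
`k² = K ≤ B e^{2Ξt}`.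
-/

noncomputable section

set_option maxSynthPendingDepth 3

/-! ### Riemannian metrics on open subsets of a vector space -/

section LocalMetric

variable {E : Type*} [NormedAddCommGroup E] [NormedSpace ℝ E]

/-- `G` is a smooth Riemannian metric on the open set `O`. -/
structure IsLocalMetric (G : E → E →L[ℝ] E →L[ℝ] ℝ) (O : Set E) : Prop where
  isOpen : IsOpen O
  smooth : ContDiffOn ℝ ∞ G O
  symm : ∀ y ∈ O, ∀ v w, G y v w = G y w v
  pos : ∀ y ∈ O, ∀ v, v ≠ 0 → 0 < G y v v

/-- `η` is a smooth one-form on `O` which is parallel for the Levi-Civita connection of `G`. -/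
structure IsLocalParallelForm (G : E → E →L[ℝ] E →L[ℝ] ℝ) (η : E → E →L[ℝ] ℝ) (O : Set E) :
    Prop where
  smooth : ContDiffOn ℝ ∞ η O
  parallel : ∀ y ∈ O, ∀ v w, fderiv ℝ η y v w = η y (christoffel G y v w)

/-- The Christoffel symbols of the first kind as a trilinear form. -/
def christoffelFirstCLM (G : E → E →L[ℝ] E →L[ℝ] ℝ) (y : E) : E →L[ℝ] E →L[ℝ] E →L[ℝ] ℝ :=
  (1 / 2 : ℝ) • (fderiv ℝ G y + (fderiv ℝ G y).flip -
    (ContinuousLinearMap.flipₗᵢ ℝ E E ℝ).toContinuousLinearEquiv.toContinuousLinearMap.comp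
      (fderiv ℝ G y).flip)

/-- The Christoffel symbols as a bilinear map. -/
def christoffelCLM (G : E → E →L[ℝ] E →L[ℝ] ℝ) (y : E) : E →L[ℝ] E →L[ℝ] E :=
  (ContinuousLinearMap.compL ℝ E (E →L[ℝ] ℝ) E (G y).inverse).comp (christoffelFirstCLM G y)

lemma christoffelFirstCLM_apply (G : E → E →L[ℝ] E →L[ℝ] ℝ) (y v w : E) :
    christoffelFirstCLM G y v w = christoffelFirst G y v w := by
  simp [christoffelFirstCLM, christoffelFirst]

lemma christoffelCLM_apply (G : E → E →L[ℝ] E →L[ℝ] ℝ) (y v w : E) :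
    christoffelCLM G y v w = christoffel G y v w := by
  simp [christoffelCLM, christoffel, christoffelFirstCLM_apply]

lemma christoffelFirst_apply (G : E → E →L[ℝ] E →L[ℝ] ℝ) (y v w z : E) :
    christoffelFirst G y v w z =
      1 / 2 * (fderiv ℝ G y v w z + fderiv ℝ G y w v z - fderiv ℝ G y z v w) := by
  simp [christoffelFirst]

lemma fderiv_bilin_apply {G : E → E →L[ℝ] E →L[ℝ] ℝ} {y : E}
    (hG : DifferentiableAt ℝ G y) (a v w : E) :
    fderiv ℝ (fun y' => G y' v w) y a = fderiv ℝ G y a v w := by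
  simp [((hG.hasFDerivAt.clm_apply (hasFDerivAt_const v y)).clm_apply
    (hasFDerivAt_const w y)).fderiv]

lemma fderiv_apply_of_pullback {G G' : E → E →L[ℝ] E →L[ℝ] ℝ} {φ : E → E} {y : E}
    (hG : DifferentiableAt ℝ G (φ y)) (hG' : DifferentiableAt ℝ G' y) (hφ : ContDiffAt ℝ 2 φ y)
    (hpull : ∀ᶠ y' in nhds y, ∀ v w, G' y' v w = G (φ y') (fderiv ℝ φ y' v) (fderiv ℝ φ y' w))
    (a b c : E) :
    fderiv ℝ G' y a b c =
      fderiv ℝ G (φ y) (fderiv ℝ φ y a) (fderiv ℝ φ y b) (fderiv ℝ φ y c) +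
        G (φ y) (fderiv ℝ (fderiv ℝ φ) y a b) (fderiv ℝ φ y c) +
        G (φ y) (fderiv ℝ φ y b) (fderiv ℝ (fderiv ℝ φ) y a c) := by
  have hφ'' : HasFDerivAt (fderiv ℝ φ) (fderiv ℝ (fderiv ℝ φ) y) y :=
    ((hφ.fderiv_right (m := 1) (by norm_cast)).differentiableAt (by simp)).hasFDerivAt
  have hGφ := hG.hasFDerivAt.comp y (hφ.differentiableAt (by simp)).hasFDerivAt
  have hderiv := (hGφ.clm_apply (hφ''.clm_apply (hasFDerivAt_const b y))).clm_apply
    (hφ''.clm_apply (hasFDerivAt_const c y))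
  have hpull' : (fun y' => G' y' b c) =ᶠ[nhds y]
      fun y' => G (φ y') (fderiv ℝ φ y' b) (fderiv ℝ φ y' c) := hpull.mono fun y' h => h b c
  rw [← fderiv_bilin_apply hG', (hderiv.congr_of_eventuallyEq hpull').fderiv]
  simp only [Function.comp_apply, ContinuousLinearMap.comp_zero, zero_add, add_apply,
    ContinuousLinearMap.comp_apply, ContinuousLinearMap.flip_apply]
  ring

namespace IsLocalMetric

variable {G : E → E →L[ℝ] E →L[ℝ] ℝ} {O : Set E} (hG : IsLocalMetric G O) {y : E}
include hG

lemma differentiableAt (hy : y ∈ O) : DifferentiableAt ℝ G y :=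
  (hG.smooth.contDiffAt (hG.isOpen.mem_nhds hy)).differentiableAt (by simp)

lemma ext_of_apply (hy : y ∈ O) {v w : E} (h : ∀ z, G y v z = G y w z) : v = w := by
  by_contra hne
  have hpos := hG.pos y hy (v - w) (sub_ne_zero.2 hne)
  simp [h] at hpos

lemma fderiv_symm (hy : y ∈ O) (a v w : E) : fderiv ℝ G y a v w = fderiv ℝ G y a w v := by
  have hsymm : (fun y' => G y' v w) =ᶠ[nhds y] fun y' => G y' w v :=
    Filter.eventually_of_mem (hG.isOpen.mem_nhds hy) fun y' hy' => hG.symm y' hy' v w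
  have hd := hG.differentiableAt hy
  rw [← fderiv_bilin_apply hd, ← fderiv_bilin_apply hd, hsymm.fderiv_eq]

variable [FiniteDimensional ℝ E]

lemma exists_equiv (hy : y ∈ O) : ∃ e : E ≃L[ℝ] (E →L[ℝ] ℝ), (e : E →L[ℝ] (E →L[ℝ] ℝ)) = G y := by
  have hinj : Function.Injective (G y : E →ₗ[ℝ] (E →L[ℝ] ℝ)) := fun v w h =>
    hG.ext_of_apply hy fun z => DFunLike.congr_fun h z
  have hdim : Module.finrank ℝ E = Module.finrank ℝ (E →L[ℝ] ℝ) := by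
    rw [← (LinearMap.toContinuousLinearMap (𝕜 := ℝ) (E := E) (F' := ℝ)).finrank_eq]
    exact (Subspace.dual_finrank_eq (K := ℝ) (V := E)).symm
  exact ⟨(LinearEquiv.ofInjectiveOfFinrankEq _ hinj hdim).toContinuousLinearEquiv, rfl⟩

lemma apply_inverse (hy : y ∈ O) (l : E →L[ℝ] ℝ) : G y ((G y).inverse l) = l := by
  obtain ⟨e, he⟩ := hG.exists_equiv hy
  simp [← he]

lemma apply_christoffel (hy : y ∈ O) (v w z : E) :
    G y (christoffel G y v w) z =
      1 / 2 * (fderiv ℝ G y v w z + fderiv ℝ G y w v z - fderiv ℝ G y z v w) := by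
  rw [christoffel, hG.apply_inverse hy, christoffelFirst_apply]

lemma christoffel_symm (hy : y ∈ O) (v w : E) : christoffel G y v w = christoffel G y w v := by
  refine hG.ext_of_apply hy fun z => ?_
  rw [hG.apply_christoffel hy, hG.apply_christoffel hy, hG.fderiv_symm hy z v w]
  ring

lemma fderiv_eq (hy : y ∈ O) (a v w : E) :
    fderiv ℝ G y a v w = G y (christoffel G y a v) w + G y v (christoffel G y a w) := by
  rw [hG.symm y hy v, hG.apply_christoffel hy, hG.apply_christoffel hy,
    hG.fderiv_symm hy w a v, hG.fderiv_symm hy a w v, hG.fderiv_symm hy v a w]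
  ring

lemma contDiffOn_christoffelCLM : ContDiffOn ℝ ∞ (christoffelCLM G) O := by
  have hfderiv : ContDiffOn ℝ ∞ (fderiv ℝ G) O := hG.smooth.fderiv_of_isOpen hG.isOpen (by simp)
  have hflip : ContDiffOn ℝ ∞ (fun y => (fderiv ℝ G y).flip) O :=
    (ContinuousLinearMap.flipₗᵢ ℝ E E (E →L[ℝ] ℝ)).contDiff.comp_contDiffOn hfderiv
  have hfirst : ContDiffOn ℝ ∞ (christoffelFirstCLM G) O :=
    ((hfderiv.add hflip).sub (contDiffOn_const.clm_comp hflip)).const_smul _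
  have hinverse : ContDiffOn ℝ ∞ (fun y => (G y).inverse) O := by
    intro y hy
    obtain ⟨e, he⟩ := hG.exists_equiv hy
    have hmap := contDiffAt_map_inverse (𝕜 := ℝ) (n := ∞) e
    rw [he] at hmap
    exact hmap.comp_contDiffWithinAt y (hG.smooth y hy)
  exact ((ContinuousLinearMap.compL ℝ E (E →L[ℝ] ℝ) E).contDiff.comp_contDiffOn
    hinverse).clm_comp hfirst

lemma hasFDerivAt_christoffelCLM (hy : y ∈ O) :
    HasFDerivAt (christoffelCLM G) (fderiv ℝ (christoffelCLM G) y) y :=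
  ((hG.contDiffOn_christoffelCLM.contDiffAt (hG.isOpen.mem_nhds hy)).differentiableAt
    (by simp)).hasFDerivAt

lemma riemannCurvature_eq (hy : y ∈ O) (a b c : E) :
    riemannCurvature G y a b c =
      fderiv ℝ (christoffelCLM G) y a b c - fderiv ℝ (christoffelCLM G) y b a c
        + christoffel G y a (christoffel G y b c) - christoffel G y b (christoffel G y a c) := by
  have hslice (a b : E) : fderiv ℝ (fun y' => christoffel G y' b c) y a =
      fderiv ℝ (christoffelCLM G) y a b c := by
    simp only [← christoffelCLM_apply]
    simp [(((hG.hasFDerivAt_christoffelCLM hy).clm_apply (hasFDerivAt_const b y)).clm_apply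
      (hasFDerivAt_const c y)).fderiv]
  rw [riemannCurvature, hslice, hslice]

lemma riemannCurvature_smul_snd (hy : y ∈ O) (a b c : E) (r : ℝ) :
    riemannCurvature G y a (r • b) c = r • riemannCurvature G y a b c := by
  simp only [hG.riemannCurvature_eq hy, ← christoffelCLM_apply, map_smul, smul_apply, smul_sub,
    smul_add]

lemma fderiv_christoffel_of_pullback {G' : E → E →L[ℝ] E →L[ℝ] ℝ} {O' : Set E}
    (hG' : IsLocalMetric G' O') {φ : E → E} (hy : y ∈ O') (hφy : φ y ∈ O)
    (hφ : ContDiffAt ℝ 2 φ y) (hsurj : Function.Surjective (fderiv ℝ φ y))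
    (hpull : ∀ᶠ y' in nhds y, ∀ v w, G' y' v w = G (φ y') (fderiv ℝ φ y' v) (fderiv ℝ φ y' w))
    (v w : E) :
    fderiv ℝ φ y (christoffel G' y v w) =
      christoffel G (φ y) (fderiv ℝ φ y v) (fderiv ℝ φ y w) + fderiv ℝ (fderiv ℝ φ) y v w := by
  have hsymm : IsSymmSndFDerivAt ℝ φ y := hφ.isSymmSndFDerivAt (by simp)
  have hderiv := fderiv_apply_of_pullback (hG.differentiableAt hφy) (hG'.differentiableAt hy)
    hφ hpull
  refine hG.ext_of_apply hφy fun z => ?_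
  obtain ⟨z, rfl⟩ := hsurj z
  rw [← hpull.self_of_nhds, hG'.apply_christoffel hy, map_add, add_apply,
    hG.apply_christoffel hφy, hderiv, hderiv, hderiv, hsymm.eq w v, hsymm.eq z v, hsymm.eq z w,
    hG.symm _ hφy (fderiv ℝ φ y w), hG.symm _ hφy (fderiv ℝ φ y v)]
  ring

end IsLocalMetric

section Splitting

variable {E₁ E₂ : Type*} [NormedAddCommGroup E₁] [NormedSpace ℝ E₁] [NormedAddCommGroup E₂]
  [NormedSpace ℝ E₂] {G : E₁ × E₂ → (E₁ × E₂) →L[ℝ] (E₁ × E₂) →L[ℝ] ℝ} {O : Set (E₁ × E₂)}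
  {G₁ : E₁ → E₁ →L[ℝ] E₁ →L[ℝ] ℝ} {η : E₂ → E₂ →L[ℝ] ℝ} {y : E₁ × E₂}

lemma fderiv_apply_of_splitting (hG : DifferentiableAt ℝ G y)
    (hG₁ : DifferentiableAt ℝ G₁ y.1) (hη : DifferentiableAt ℝ η y.2)
    (hsplit : ∀ᶠ y' in nhds y, ∀ v w, G y' v w = G₁ y'.1 v.1 w.1 + η y'.2 v.2 * η y'.2 w.2)
    (a b c : E₁ × E₂) :
    fderiv ℝ G y a b c = fderiv ℝ G₁ y.1 a.1 b.1 c.1 +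
      (fderiv ℝ η y.2 a.2 b.2 * η y.2 c.2 + η y.2 b.2 * fderiv ℝ η y.2 a.2 c.2) := by
  have hd₁ : HasFDerivAt (fun y' : E₁ × E₂ => G₁ y'.1) _ y := hG₁.hasFDerivAt.comp y hasFDerivAt_fst
  have hd₂ : HasFDerivAt (fun y' : E₁ × E₂ => η y'.2) _ y := hη.hasFDerivAt.comp y hasFDerivAt_snd
  have hderiv := ((hd₁.clm_apply (hasFDerivAt_const b.1 y)).clm_apply
    (hasFDerivAt_const c.1 y)).add ((hd₂.clm_apply (hasFDerivAt_const b.2 y)).mul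
      (hd₂.clm_apply (hasFDerivAt_const c.2 y)))
  have heq : (fun y' => G y' b c) =ᶠ[nhds y]
      fun y' => G₁ y'.1 b.1 c.1 + η y'.2 b.2 * η y'.2 c.2 :=
    hsplit.mono fun y' h => h b c
  rw [← fderiv_bilin_apply hG, (hderiv.congr_of_eventuallyEq heq).fderiv]
  simp
  ring

lemma IsLocalMetric.fderiv_eq_christoffel_of_splitting [FiniteDimensional ℝ E₁]
    [FiniteDimensional ℝ E₂] (hG : IsLocalMetric G O) (hy : y ∈ O)
    (hG₁ : DifferentiableAt ℝ G₁ y.1) (hη : DifferentiableAt ℝ η y.2)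
    (hclosed : ∀ v w, fderiv ℝ η y.2 v w = fderiv ℝ η y.2 w v) (hne : η y.2 ≠ 0)
    (hsplit : ∀ y ∈ O, ∀ v w, G y v w = G₁ y.1 v.1 w.1 + η y.2 v.2 * η y.2 w.2)
    (v w : E₁ × E₂) : fderiv ℝ η y.2 v.2 w.2 = η y.2 (christoffel G y v w).2 := by
  obtain ⟨u, hu⟩ : ∃ u, η y.2 u ≠ 0 := by
    by_contra! h
    exact hne (ContinuousLinearMap.ext h)
  have hderiv := fderiv_apply_of_splitting (hG.differentiableAt hy) hG₁ hη
    (Filter.eventually_of_mem (hG.isOpen.mem_nhds hy) hsplit)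
  have hΓ := hG.apply_christoffel hy v w (0, u)
  rw [hsplit y hy, hderiv, hderiv, hderiv, hclosed u v.2, hclosed u w.2, hclosed w.2 v.2] at hΓ
  simp only [map_zero, zero_add, zero_apply] at hΓ
  refine mul_right_cancel₀ hu ?_
  rw [hΓ]
  ring

lemma IsLocalMetric.isLocalParallelForm_of_splitting [FiniteDimensional ℝ E₁]
    [FiniteDimensional ℝ E₂] (hG : IsLocalMetric G O)
    (hG₁ : ∀ y ∈ O, DifferentiableAt ℝ G₁ y.1) (hη : ∀ y ∈ O, ContDiffAt ℝ ∞ η y.2)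
    (hclosed : ∀ y ∈ O, ∀ v w, fderiv ℝ η y.2 v w = fderiv ℝ η y.2 w v)
    (hne : ∀ y ∈ O, η y.2 ≠ 0)
    (hsplit : ∀ y ∈ O, ∀ v w, G y v w = G₁ y.1 v.1 w.1 + η y.2 v.2 * η y.2 w.2) :
    IsLocalParallelForm G (fun y => (η y.2).comp (ContinuousLinearMap.snd ℝ E₁ E₂)) O where
  smooth y hy := (((hη y hy).comp y contDiffAt_snd).clm_comp contDiffAt_const).contDiffWithinAt
  parallel y hy v w := by
    have hη' : DifferentiableAt ℝ η y.2 := (hη y hy).differentiableAt (by simp)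
    have hd : HasFDerivAt (fun y' : E₁ × E₂ => η y'.2) _ y := hη'.hasFDerivAt.comp y hasFDerivAt_snd
    rw [(hd.clm_comp (hasFDerivAt_const _ y)).fderiv]
    simpa using hG.fderiv_eq_christoffel_of_splitting hy (hG₁ y hy) hη' (hclosed y hy) (hne y hy)
      hsplit v w

end Splitting

section ParallelForm

variable {G : E → E →L[ℝ] E →L[ℝ] ℝ} {η η' : E → E →L[ℝ] ℝ} {O : Set E}

lemma IsLocalParallelForm.congr (hη : IsLocalParallelForm G η O) (hO : IsOpen O)
    (heq : Set.EqOn η' η O) : IsLocalParallelForm G η' O where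
  smooth := hη.smooth.congr heq
  parallel y hy v w := by
    rw [(heq.eventuallyEq_of_mem (hO.mem_nhds hy)).fderiv_eq, heq hy, hη.parallel y hy]

lemma IsLocalParallelForm.const_smul (hη : IsLocalParallelForm G η O) (r : ℝ) :
    IsLocalParallelForm G (fun y => r • η y) O where
  smooth := hη.smooth.const_smul r
  parallel y hy v w := by
    have hd : fderiv ℝ (fun y => r • η y) = r • fderiv ℝ η := fderiv_const_smul_field r
    rw [hd, Pi.smul_apply, smul_apply, smul_apply, smul_apply, hη.parallel y hy]

end ParallelForm

end LocalMetric

/-! ### Covariant derivatives along a map -/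

section AlongMap

variable {E : Type*} [NormedAddCommGroup E] [NormedSpace ℝ E]
  {F : Type*} [NormedAddCommGroup F] [NormedSpace ℝ F]

/-- The covariant derivative in the direction `e` of a vector field `V` along the map `x`. -/
def covAlong (G : E → E →L[ℝ] E →L[ℝ] ℝ) (x : F → E) (e : F) (V : F → E) (q : F) : E :=
  fderiv ℝ V q e + christoffel G (x q) (fderiv ℝ x q e) (V q)

lemma contDiffOn_fderiv_apply {f : F → E} {Ω : Set F} (hΩ : IsOpen Ω) (hf : ContDiffOn ℝ ∞ f Ω)
    (e : F) : ContDiffOn ℝ ∞ (fun q => fderiv ℝ f q e) Ω :=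
  (hf.fderiv_of_isOpen hΩ (by simp)).clm_apply contDiffOn_const

lemma differentiableAt_of_contDiffOn {f : F → E} {Ω : Set F} {q : F} (hf : ContDiffOn ℝ ∞ f Ω)
    (hΩ : Ω ∈ nhds q) : DifferentiableAt ℝ f q :=
  (hf.contDiffAt hΩ).differentiableAt (by simp)

lemma differentiableAt_fderiv_apply {f : F → E} {q : F} (hf : ContDiffAt ℝ 2 f q) (e : F) :
    DifferentiableAt ℝ (fun q' => fderiv ℝ f q' e) q :=
  ((hf.fderiv_right (m := 1) (by norm_cast)).differentiableAt (by simp)).clm_apply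
    (differentiableAt_const e)

lemma fderiv_fderiv_apply_comm {f : F → E} {q : F} (hf : ContDiffAt ℝ 2 f q) (e₁ e₂ : F) :
    fderiv ℝ (fun q => fderiv ℝ f q e₁) q e₂ = fderiv ℝ (fun q => fderiv ℝ f q e₂) q e₁ := by
  have hd : DifferentiableAt ℝ (fderiv ℝ f) q :=
    (hf.fderiv_right (m := 1) (by norm_cast)).differentiableAt (by simp)
  have hsymm : IsSymmSndFDerivAt ℝ f q := hf.isSymmSndFDerivAt (by simp)
  rw [fderiv_clm_apply hd (differentiableAt_const _),
    fderiv_clm_apply hd (differentiableAt_const _)]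
  simpa using hsymm.eq e₂ e₁

variable {G : E → E →L[ℝ] E →L[ℝ] ℝ} {x : F → E} {V W : F → E} {q : F}

lemma covAlong_smul {f : F → ℝ} (hf : DifferentiableAt ℝ f q) (hV : DifferentiableAt ℝ V q)
    (e : F) :
    covAlong G x e (fun q => f q • V q) q = fderiv ℝ f q e • V q + f q • covAlong G x e V q := by
  simp only [covAlong, fderiv_fun_smul hf hV, ← christoffelCLM_apply, map_smul, smul_add,
    add_apply, smul_apply, ContinuousLinearMap.smulRight_apply]
  abel

lemma covAlong_add (hV : DifferentiableAt ℝ V q) (hW : DifferentiableAt ℝ W q) (e : F) :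
    covAlong G x e (fun q => V q + W q) q = covAlong G x e V q + covAlong G x e W q := by
  simp only [covAlong, fderiv_fun_add hV hW, ← christoffelCLM_apply, map_add, add_apply]
  abel

lemma covAlong_congr (h : V =ᶠ[nhds q] W) (e : F) : covAlong G x e V q = covAlong G x e W q := by
  rw [covAlong, covAlong, h.fderiv_eq, h.self_of_nhds]

lemma fderiv_parallelForm_apply {η : E → E →L[ℝ] ℝ} {O : Set E} (hO : IsOpen O)
    (hη : IsLocalParallelForm G η O) (hx : DifferentiableAt ℝ x q) (hxO : x q ∈ O)
    (hV : DifferentiableAt ℝ V q) (e : F) :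
    fderiv ℝ (fun q => η (x q) (V q)) q e = η (x q) (covAlong G x e V q) := by
  have hd : HasFDerivAt (fun q => η (x q) (V q)) _ q :=
    ((differentiableAt_of_contDiffOn hη.smooth (hO.mem_nhds hxO)).hasFDerivAt.comp q
      hx.hasFDerivAt).clm_apply hV.hasFDerivAt
  rw [hd.fderiv]
  simp [covAlong, hη.parallel _ hxO]

variable [FiniteDimensional ℝ E] {O : Set E} (hG : IsLocalMetric G O)
include hG

lemma contDiffOn_covAlong {Ω : Set F} (hΩ : IsOpen Ω) (hx : ContDiffOn ℝ ∞ x Ω)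
    (hxO : Set.MapsTo x Ω O) (hV : ContDiffOn ℝ ∞ V Ω) (e : F) :
    ContDiffOn ℝ ∞ (covAlong G x e V) Ω := by
  have hΓ : ContDiffOn ℝ ∞ (fun q => christoffelCLM G (x q) (fderiv ℝ x q e) (V q)) Ω :=
    ((hG.contDiffOn_christoffelCLM.comp hx hxO).clm_apply
      (contDiffOn_fderiv_apply hΩ hx e)).clm_apply hV
  simp only [christoffelCLM_apply] at hΓ
  exact (contDiffOn_fderiv_apply hΩ hV e).add hΓ

lemma covAlong_fderiv_comm (hx : ContDiffAt ℝ 2 x q) (hxO : x q ∈ O) (e₁ e₂ : F) :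
    covAlong G x e₁ (fun q => fderiv ℝ x q e₂) q =
      covAlong G x e₂ (fun q => fderiv ℝ x q e₁) q := by
  rw [covAlong, covAlong, fderiv_fderiv_apply_comm hx, hG.christoffel_symm hxO]

lemma fderiv_metric_apply (hx : DifferentiableAt ℝ x q) (hxO : x q ∈ O)
    (hV : DifferentiableAt ℝ V q) (hW : DifferentiableAt ℝ W q) (e : F) :
    fderiv ℝ (fun q => G (x q) (V q) (W q)) q e =
      G (x q) (covAlong G x e V q) (W q) + G (x q) (V q) (covAlong G x e W q) := by
  have hd : HasFDerivAt (fun q => G (x q) (V q) (W q)) _ q :=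
    (((hG.differentiableAt hxO).hasFDerivAt.comp q hx.hasFDerivAt).clm_apply
      hV.hasFDerivAt).clm_apply hW.hasFDerivAt
  rw [hd.fderiv]
  simp only [covAlong, Function.comp_apply, add_apply, map_add, ContinuousLinearMap.comp_apply,
    ContinuousLinearMap.flip_apply, hG.fderiv_eq hxO]
  ring

lemma covAlong_covAlong (hx : ContDiffAt ℝ 2 x q) (hxO : x q ∈ O) (hV : ContDiffAt ℝ 2 V q)
    (e₁ e₂ : F) :
    covAlong G x e₁ (covAlong G x e₂ V) q =
      fderiv ℝ (fun q => fderiv ℝ V q e₂) q e₁ +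
        christoffel G (x q) (fderiv ℝ (fun q => fderiv ℝ x q e₂) q e₁) (V q) +
        (christoffel G (x q) (fderiv ℝ x q e₂) (fderiv ℝ V q e₁) +
          christoffel G (x q) (fderiv ℝ x q e₁) (fderiv ℝ V q e₂)) +
        (fderiv ℝ (christoffelCLM G) (x q) (fderiv ℝ x q e₁) (fderiv ℝ x q e₂) (V q) +
          christoffel G (x q) (fderiv ℝ x q e₁)
            (christoffel G (x q) (fderiv ℝ x q e₂) (V q))) := by
  have hΓ := (hG.hasFDerivAt_christoffelCLM hxO).comp q (hx.differentiableAt (by simp)).hasFDerivAt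
  have hd : HasFDerivAt (fun q => fderiv ℝ V q e₂ +
      christoffelCLM G (x q) (fderiv ℝ x q e₂) (V q)) _ q :=
    (differentiableAt_fderiv_apply hV e₂).hasFDerivAt.add
      ((hΓ.clm_apply (differentiableAt_fderiv_apply hx e₂).hasFDerivAt).clm_apply
        (hV.differentiableAt (by simp)).hasFDerivAt)
  have heq : covAlong G x e₂ V = fun q => fderiv ℝ V q e₂ +
      christoffelCLM G (x q) (fderiv ℝ x q e₂) (V q) := by
    ext q
    rw [covAlong, christoffelCLM_apply]
  rw [covAlong, heq, hd.fderiv]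
  simp only [← christoffelCLM_apply, Function.comp_apply, add_apply, map_add,
    ContinuousLinearMap.comp_apply, ContinuousLinearMap.flip_apply]
  abel

lemma covAlong_covAlong_sub (hx : ContDiffAt ℝ 2 x q) (hxO : x q ∈ O) (hV : ContDiffAt ℝ 2 V q)
    (e₁ e₂ : F) :
    covAlong G x e₁ (covAlong G x e₂ V) q - covAlong G x e₂ (covAlong G x e₁ V) q =
      riemannCurvature G (x q) (fderiv ℝ x q e₁) (fderiv ℝ x q e₂) (V q) := by
  rw [covAlong_covAlong hG hx hxO hV, covAlong_covAlong hG hx hxO hV, hG.riemannCurvature_eq hxO,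
    fderiv_fderiv_apply_comm hV e₂ e₁, fderiv_fderiv_apply_comm hx e₂ e₁]
  abel

end AlongMap

/-! ### The maximum principle -/

section MaximumPrinciple

lemma deriv_deriv_nonpos_of_isLocalMax {f : ℝ → ℝ} {a : ℝ} (h : IsLocalMax f a)
    (hf : ContinuousAt f a) : deriv (deriv f) a ≤ 0 := by
  by_contra! hpos
  have hmin : IsLocalMin f a := isLocalMin_of_deriv_deriv_pos hpos h.deriv_eq_zero hf
  have hconst : f =ᶠ[nhds a] fun _ => f a := by
    filter_upwards [h, hmin] with b hle hge using le_antisymm hle hge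
  have hderiv : deriv f =ᶠ[nhds a] fun _ => 0 := hconst.deriv.trans (by simp)
  simp [hderiv.deriv_eq] at hpos

section PastMaximum

variable {w : ℝ × ℝ → ℝ} {q : ℝ × ℝ} (h : IsLocalMaxOn w {q' | q'.2 ≤ q.2} q)
include h

lemma fderiv_nonpos_of_isLocalMaxOn_past {e : ℝ × ℝ} (he : e.2 ≤ 0) (hw : DifferentiableAt ℝ w q) :
    fderiv ℝ w q e ≤ 0 := by
  refine h.hasFDerivWithinAt_nonpos hw.hasFDerivAt.hasFDerivWithinAt
    (mem_posTangentConeAt_of_segment_subset ?_)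
  have hconvex : Convex ℝ {q' : ℝ × ℝ | q'.2 ≤ q.2} :=
    convex_halfSpace_le (LinearMap.snd ℝ ℝ ℝ).isLinear q.2
  exact hconvex.segment_subset (by simp) (by simpa using he)

lemma fderiv_space_eq_zero_of_isLocalMaxOn_past (hw : DifferentiableAt ℝ w q) :
    fderiv ℝ w q (1, 0) = 0 := by
  have hneg := fderiv_nonpos_of_isLocalMaxOn_past h (e := -(1, 0)) (by simp) hw
  rw [map_neg] at hneg
  exact le_antisymm (fderiv_nonpos_of_isLocalMaxOn_past h le_rfl hw) (by linarith)

lemma fderiv_time_nonneg_of_isLocalMaxOn_past (hw : DifferentiableAt ℝ w q) :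
    0 ≤ fderiv ℝ w q (0, 1) := by
  have hneg := fderiv_nonpos_of_isLocalMaxOn_past h (e := -(0, 1)) (by simp) hw
  rw [map_neg] at hneg
  linarith

lemma fderiv_space_space_nonpos_of_isLocalMaxOn_past (hw : ContDiffAt ℝ 2 w q) :
    fderiv ℝ (fun q' => fderiv ℝ w q' (1, 0)) q (1, 0) ≤ 0 := by
  have hline (b : ℝ) : HasDerivAt (fun b : ℝ => (b, q.2)) ((1, 0) : ℝ × ℝ) b :=
    (hasDerivAt_id b).prodMk (hasDerivAt_const b q.2)
  have hmax : IsLocalMax (fun b => w (b, q.2)) q.1 :=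
    h.comp_tendsto (g := fun b => (b, q.2)) (b := q.1) <| tendsto_nhdsWithin_iff.2
      ⟨(hline q.1).continuousAt, Filter.Eventually.of_forall fun _ => by simp⟩
  have hderiv : deriv (fun b => w (b, q.2)) =ᶠ[nhds q.1] fun b => fderiv ℝ w (b, q.2) (1, 0) := by
    filter_upwards [(hline q.1).continuousAt.eventually (hw.eventually (by simp))] with b hb
    exact ((hb.differentiableAt (by simp)).hasFDerivAt.comp_hasDerivAt b (hline b)).deriv
  have hderiv₂ := (differentiableAt_fderiv_apply hw (1, 0)).hasFDerivAt.comp_hasDerivAt q.1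
    (hline q.1)
  rw [← hderiv₂.deriv]
  refine Eq.trans_le hderiv.deriv_eq.symm ?_
  exact deriv_deriv_nonpos_of_isLocalMax hmax <|
    hw.continuousAt.comp (f := fun b => (b, q.2)) (hline q.1).continuousAt

end PastMaximum

section FirstZero

variable {S : Set ℝ} {w : ℝ → ℝ → ℝ} {c : ℝ}

lemma exists_first_nonneg_of_periodic {t₀ : ℝ} (ht₀ : 0 ≤ t₀)
    (hw : ContinuousOn (fun q : ℝ × ℝ => w q.1 q.2) (Set.univ ×ˢ Set.Icc 0 t₀)) (hc : 0 < c)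
    (hper : ∀ t ∈ Set.Icc 0 t₀, Function.Periodic (fun a => w a t) c) {a₀ : ℝ}
    (ha₀ : 0 ≤ w a₀ t₀) :
    ∃ t ∈ Set.Icc 0 t₀, (∃ a, 0 ≤ w a t) ∧ ∀ b, ∀ s ∈ Set.Ico 0 t, w b s < 0 := by
  have hred : ∀ s ∈ Set.Icc 0 t₀, ∀ b, ∃ b' ∈ Set.Icc 0 c, w b s = w b' s := fun s hs b =>
    let ⟨b', hb', h⟩ := (hper s hs).exists_mem_Ico₀ hc b
    ⟨b', Set.Ico_subset_Icc_self hb', h⟩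
  let A : Set (ℝ × ℝ) :=
    Set.Icc 0 c ×ˢ Set.Icc 0 t₀ ∩ (fun q : ℝ × ℝ => w q.1 q.2) ⁻¹' Set.Ici 0
  have hA : IsCompact A := (isCompact_Icc.prod isCompact_Icc).of_isClosed_subset
    ((hw.mono (Set.prod_mono_left (Set.subset_univ _))).preimage_isClosed_of_isClosed
      (isClosed_Icc.prod isClosed_Icc) isClosed_Ici) Set.inter_subset_left
  have hne : A.Nonempty := by
    obtain ⟨a, ha, h⟩ := hred t₀ ⟨ht₀, le_rfl⟩ a₀
    exact ⟨(a, t₀), ⟨ha, ht₀, le_rfl⟩, by simpa [← h] using ha₀⟩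
  obtain ⟨⟨a, t⟩, ⟨⟨-, ht⟩, ha⟩, hmin⟩ := hA.exists_isMinOn hne continuousOn_snd
  refine ⟨t, ht, ⟨a, ha⟩, fun b s hs => ?_⟩
  by_contra! hb
  have hs' : s ∈ Set.Icc 0 t₀ := ⟨hs.1, hs.2.le.trans ht.2⟩
  obtain ⟨b', hb', h⟩ := hred s hs' b
  have hmem : (b', s) ∈ A := ⟨⟨hb', hs'⟩, by simpa [← h] using hb⟩
  exact absurd hs.2 (not_lt.2 (hmin hmem))

lemma nonpos_of_neg_on_Ico {f : ℝ → ℝ} {t : ℝ} (ht : 0 < t) (hf : ContinuousOn f (Set.Icc 0 t))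
    (hneg : ∀ s ∈ Set.Ico 0 t, f s < 0) : ∀ s ∈ Set.Icc 0 t, f s ≤ 0 := by
  have hclosure : Set.Icc 0 t ⊆ closure (Set.Ico 0 t) := (closure_Ico ht.ne).ge
  intro s hs
  refine ContinuousWithinAt.closure_le (hclosure hs) ((hf s hs).mono Set.Ico_subset_Icc_self)
    continuousWithinAt_const fun r hr => (hneg r hr).le

lemma neg_of_no_first_zero (hS : ∀ t ∈ S, 0 ≤ t ∧ Set.Icc 0 t ⊆ S)
    (hw : ContinuousOn (fun q : ℝ × ℝ => w q.1 q.2) (Set.univ ×ˢ S)) (hc : 0 < c)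
    (hper : ∀ t ∈ S, Function.Periodic (fun a => w a t) c) (h0 : ∀ a, w a 0 < 0)
    (hstep : ∀ t ∈ S, 0 < t → ∀ a, w a t = 0 → (∀ b, ∀ s ∈ Set.Icc 0 t, w b s ≤ 0) → False) :
    ∀ t ∈ S, ∀ a, w a t < 0 := by
  intro t₀ ht₀ a₀
  by_contra! ha₀
  obtain ⟨ht₀0, hsub⟩ := hS t₀ ht₀
  obtain ⟨t, ht, ⟨a, ha⟩, hbefore⟩ := exists_first_nonneg_of_periodic ht₀0
    (hw.mono (Set.prod_mono_right hsub)) hc (fun t ht => hper t (hsub ht)) ha₀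
  have hpos : 0 < t := ht.1.lt_of_ne fun h => (h0 a).not_ge (h ▸ ha)
  have hline (b : ℝ) : ContinuousOn (w b) (Set.Icc 0 t) :=
    hw.comp (f := fun s => (b, s)) (by fun_prop) fun s hs =>
      ⟨Set.mem_univ _, hsub ⟨hs.1, hs.2.trans ht.2⟩⟩
  have hle (b : ℝ) := nonpos_of_neg_on_Ico hpos (hline b) (hbefore b)
  exact hstep t (hsub ht) hpos a (le_antisymm (hle a t ⟨hpos.le, le_rfl⟩) ha) hle

end FirstZero

lemma exists_pos_forall_lt_of_periodic {f : ℝ → ℝ} {c : ℝ} (hf : Continuous f)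
    (hper : Function.Periodic f c) (hc : c ≠ 0) (hpos : ∀ a, 0 < f a) : ∃ δ > 0, ∀ a, δ < f a := by
  obtain ⟨_, ⟨m, rfl⟩, hm⟩ :=
    (hper.compact_of_continuous hc hf).exists_isLeast (Set.range_nonempty f)
  exact ⟨f m / 2, half_pos (hpos m), fun a => (half_lt_self (hpos m)).trans_le (hm ⟨a, rfl⟩)⟩

end MaximumPrinciple

/-! ### Families of immersed curves in a chart -/

section ChartCurve

variable {E : Type*} [NormedAddCommGroup E] [NormedSpace ℝ E]
  {F : Type*} [NormedAddCommGroup F] [NormedSpace ℝ F]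

section Defs

variable (G : E → E →L[ℝ] E →L[ℝ] ℝ) (x : F → E) (e : F)

/-- The speed of the curves `b ↦ x (q + b e)`. Taking `F = ℝ` gives a single curve and
`F = ℝ × ℝ`, `e = (1, 0)` a time dependent one. -/
def chartSpeed (q : F) : ℝ := √(G (x q) (fderiv ℝ x q e) (fderiv ℝ x q e))

/-- The derivative `∂/∂s` of a function by the arc length of the curves `b ↦ x (q + b e)`. -/
def arcDeriv (f : F → ℝ) (q : F) : ℝ := (chartSpeed G x e q)⁻¹ * fderiv ℝ f q e

/-- The covariant derivative `D/∂s` of a vector field by the arc length of the curves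
`b ↦ x (q + b e)`. -/
def arcCov (V : F → E) (q : F) : E := (chartSpeed G x e q)⁻¹ • covAlong G x e V q

/-- The unit tangent field `T` of the curves `b ↦ x (q + b e)`. -/
def chartTangent (q : F) : E := (chartSpeed G x e q)⁻¹ • fderiv ℝ x q e

/-- The curvature vector field `DT/∂s` of the curves `b ↦ x (q + b e)`. -/
def chartCurvature : F → E := arcCov G x e (chartTangent G x e)

/-- The squared curvature `|DT/∂s|²` of the curves `b ↦ x (q + b e)`. -/
def chartCurvatureSq (q : F) : ℝ := G (x q) (chartCurvature G x e q) (chartCurvature G x e q)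

end Defs

section Derivation

variable {G : E → E →L[ℝ] E →L[ℝ] ℝ} {x : F → E} {e : F} {f f' : F → ℝ} {q : F}

lemma arcDeriv_add (hf : DifferentiableAt ℝ f q) (hf' : DifferentiableAt ℝ f' q) :
    arcDeriv G x e (fun q => f q + f' q) q = arcDeriv G x e f q + arcDeriv G x e f' q := by
  rw [arcDeriv, fderiv_fun_add hf hf', add_apply, mul_add, arcDeriv, arcDeriv]

lemma arcDeriv_const_mul (hf : DifferentiableAt ℝ f q) (r : ℝ) :
    arcDeriv G x e (fun q => r * f q) q = r * arcDeriv G x e f q := by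
  rw [arcDeriv, fderiv_const_mul hf, smul_apply, smul_eq_mul, arcDeriv, mul_left_comm]

lemma arcDeriv_sub (hf : DifferentiableAt ℝ f q) (hf' : DifferentiableAt ℝ f' q) :
    arcDeriv G x e (fun q => f q - f' q) q = arcDeriv G x e f q - arcDeriv G x e f' q := by
  rw [arcDeriv, fderiv_fun_sub hf hf', sub_apply, mul_sub, arcDeriv, arcDeriv]

lemma arcDeriv_mul (hf : DifferentiableAt ℝ f q) (hf' : DifferentiableAt ℝ f' q) :
    arcDeriv G x e (fun q => f q * f' q) q =
      arcDeriv G x e f q * f' q + f q * arcDeriv G x e f' q := by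
  simp only [arcDeriv, fderiv_fun_mul hf hf', add_apply, smul_apply, smul_eq_mul]
  ring

lemma arcDeriv_congr (h : f =ᶠ[nhds q] f') : arcDeriv G x e f q = arcDeriv G x e f' q := by
  rw [arcDeriv, arcDeriv, h.fderiv_eq]

lemma arcDeriv_arcDeriv_of_fderiv_eq_zero (hσ : DifferentiableAt ℝ (chartSpeed G x e) q)
    (hpos : 0 < chartSpeed G x e q) (hf : ContDiffAt ℝ 2 f q) (h0 : fderiv ℝ f q e = 0) :
    arcDeriv G x e (arcDeriv G x e f) q =
      (chartSpeed G x e q)⁻¹ ^ 2 * fderiv ℝ (fun q' => fderiv ℝ f q' e) q e := by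
  have heq : arcDeriv G x e f = fun q' => (chartSpeed G x e q')⁻¹ * fderiv ℝ f q' e := rfl
  rw [arcDeriv, heq, fderiv_fun_mul (hσ.fun_inv hpos.ne') (differentiableAt_fderiv_apply hf e)]
  simp only [add_apply, smul_apply, smul_eq_mul, h0]
  ring

end Derivation

/-- The curves `b ↦ x (q + b e)` in the open set `Ω` are smooth and immersed, with values in
`(O, G)`. -/
structure IsImmersedInChart (G : E → E →L[ℝ] E →L[ℝ] ℝ) (O : Set E) (x : F → E) (e : F)
    (Ω : Set F) : Prop where
  metric : IsLocalMetric G O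
  isOpen : IsOpen Ω
  smooth : ContDiffOn ℝ ∞ x Ω
  mapsTo : Set.MapsTo x Ω O
  immersed : ∀ q ∈ Ω, fderiv ℝ x q e ≠ 0

lemma IsLocalMetric.nonneg {G : E → E →L[ℝ] E →L[ℝ] ℝ} {O : Set E} (hG : IsLocalMetric G O)
    {y : E} (hy : y ∈ O) (v : E) : 0 ≤ G y v v := by
  rcases eq_or_ne v 0 with rfl | hv
  · simp
  · exact (hG.pos y hy v hv).le

lemma IsLocalMetric.bessel {G : E → E →L[ℝ] E →L[ℝ] ℝ} {O : Set E} (hG : IsLocalMetric G O)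
    {y : E} (hy : y ∈ O) {v w : E} (hv : G y v v = 1) (hw : 0 < G y w w) (hvw : G y w v = 0)
    (p : E) : G y p v ^ 2 + G y p w ^ 2 / G y w w ≤ G y p p := by
  have hnonneg := hG.nonneg hy (p - G y p v • v - (G y p w / G y w w) • w)
  simp only [map_sub, map_smul, sub_apply, smul_apply, smul_eq_mul, hv, hvw, hG.symm y hy v w,
    hG.symm y hy v p, hG.symm y hy w p] at hnonneg
  have hcancel : G y p w / G y w w * (G y p w / G y w w * G y w w) = G y p w ^ 2 / G y w w := by
    field_simp
  have hcancel' : G y p w / G y w w * G y p w = G y p w ^ 2 / G y w w := by ring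
  linarith

namespace IsImmersedInChart

variable {G : E → E →L[ℝ] E →L[ℝ] ℝ} {O : Set E} {η : E → E →L[ℝ] ℝ} {x : F → E} {e : F}
  {Ω : Set F} (h : IsImmersedInChart G O x e Ω) {q : F}

section Regularity

include h

lemma eventually_mem (hq : q ∈ Ω) : ∀ᶠ q' in nhds q, q' ∈ Ω := h.isOpen.mem_nhds hq

lemma differentiableAt_of_contDiffOn {E' : Type*} [NormedAddCommGroup E'] [NormedSpace ℝ E']
    {f : F → E'} (hf : ContDiffOn ℝ ∞ f Ω) (hq : q ∈ Ω) : DifferentiableAt ℝ f q :=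
  _root_.differentiableAt_of_contDiffOn hf (h.eventually_mem hq)

lemma contDiffAt_two (hq : q ∈ Ω) : ContDiffAt ℝ 2 x q :=
  (h.smooth.contDiffAt (h.eventually_mem hq)).of_le (by norm_cast)

lemma contDiffOn_metric {V W : F → E} (hV : ContDiffOn ℝ ∞ V Ω) (hW : ContDiffOn ℝ ∞ W Ω) :
    ContDiffOn ℝ ∞ (fun q => G (x q) (V q) (W q)) Ω :=
  ((h.metric.smooth.comp h.smooth h.mapsTo).clm_apply hV).clm_apply hW

lemma contDiffOn_form (hη : ContDiffOn ℝ ∞ η O) {V : F → E} (hV : ContDiffOn ℝ ∞ V Ω) :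
    ContDiffOn ℝ ∞ (fun q => η (x q) (V q)) Ω :=
  (hη.comp h.smooth h.mapsTo).clm_apply hV

lemma metric_fderiv_pos (hq : q ∈ Ω) : 0 < G (x q) (fderiv ℝ x q e) (fderiv ℝ x q e) :=
  h.metric.pos _ (h.mapsTo hq) _ (h.immersed q hq)

lemma speed_pos (hq : q ∈ Ω) : 0 < chartSpeed G x e q := Real.sqrt_pos.2 (h.metric_fderiv_pos hq)

lemma contDiffOn_fderiv : ContDiffOn ℝ ∞ (fun q => fderiv ℝ x q e) Ω :=
  contDiffOn_fderiv_apply h.isOpen h.smooth e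

lemma contDiffOn_speed : ContDiffOn ℝ ∞ (chartSpeed G x e) Ω :=
  (h.contDiffOn_metric h.contDiffOn_fderiv h.contDiffOn_fderiv).sqrt
    fun _ hq => (h.metric_fderiv_pos hq).ne'

lemma contDiffOn_speed_inv : ContDiffOn ℝ ∞ (fun q => (chartSpeed G x e q)⁻¹) Ω :=
  h.contDiffOn_speed.inv fun _ hq => (h.speed_pos hq).ne'

lemma contDiffOn_arcDeriv {f : F → ℝ} (hf : ContDiffOn ℝ ∞ f Ω) :
    ContDiffOn ℝ ∞ (arcDeriv G x e f) Ω :=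
  h.contDiffOn_speed_inv.mul (contDiffOn_fderiv_apply h.isOpen hf e)

lemma contDiffOn_tangent : ContDiffOn ℝ ∞ (chartTangent G x e) Ω :=
  h.contDiffOn_speed_inv.smul h.contDiffOn_fderiv

variable [FiniteDimensional ℝ E]

lemma contDiffOn_cov {V : F → E} (hV : ContDiffOn ℝ ∞ V Ω) (e' : F) :
    ContDiffOn ℝ ∞ (covAlong G x e' V) Ω :=
  contDiffOn_covAlong h.metric h.isOpen h.smooth h.mapsTo hV e'

lemma contDiffOn_arcCov {V : F → E} (hV : ContDiffOn ℝ ∞ V Ω) :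
    ContDiffOn ℝ ∞ (arcCov G x e V) Ω :=
  h.contDiffOn_speed_inv.smul (h.contDiffOn_cov hV e)

lemma contDiffOn_curvature : ContDiffOn ℝ ∞ (chartCurvature G x e) Ω :=
  h.contDiffOn_arcCov h.contDiffOn_tangent

lemma contDiffOn_curvatureSq : ContDiffOn ℝ ∞ (chartCurvatureSq G x e) Ω :=
  h.contDiffOn_metric h.contDiffOn_curvature h.contDiffOn_curvature

end Regularity

section Frame

include h

lemma fderiv_eq_smul_tangent (hq : q ∈ Ω) :
    fderiv ℝ x q e = chartSpeed G x e q • chartTangent G x e q := by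
  rw [chartTangent, smul_inv_smul₀ (h.speed_pos hq).ne']

lemma covAlong_eq_smul_arcCov (hq : q ∈ Ω) (V : F → E) :
    covAlong G x e V q = chartSpeed G x e q • arcCov G x e V q := by
  rw [arcCov, smul_inv_smul₀ (h.speed_pos hq).ne']

lemma metric_fderiv_fderiv (hq : q ∈ Ω) :
    G (x q) (fderiv ℝ x q e) (fderiv ℝ x q e) = chartSpeed G x e q ^ 2 :=
  (Real.sq_sqrt (h.metric_fderiv_pos hq).le).symm

lemma metric_tangent_tangent (hq : q ∈ Ω) :
    G (x q) (chartTangent G x e q) (chartTangent G x e q) = 1 := by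
  have hσ := (h.speed_pos hq).ne'
  simp only [chartTangent, map_smul, smul_apply, smul_eq_mul, h.metric_fderiv_fderiv hq]
  field_simp

lemma arcDeriv_form (hη : IsLocalParallelForm G η O) {V : F → E} (hV : ContDiffOn ℝ ∞ V Ω)
    (hq : q ∈ Ω) :
    arcDeriv G x e (fun q => η (x q) (V q)) q = η (x q) (arcCov G x e V q) := by
  rw [arcDeriv, arcCov, map_smul, smul_eq_mul, fderiv_parallelForm_apply h.metric.isOpen hη
    (h.differentiableAt_of_contDiffOn h.smooth hq) (h.mapsTo hq)
    (h.differentiableAt_of_contDiffOn hV hq)]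

lemma arcCov_add {V W : F → E} (hV : ContDiffOn ℝ ∞ V Ω) (hW : ContDiffOn ℝ ∞ W Ω) (hq : q ∈ Ω) :
    arcCov G x e (fun q => V q + W q) q = arcCov G x e V q + arcCov G x e W q := by
  rw [arcCov, covAlong_add (h.differentiableAt_of_contDiffOn hV hq)
    (h.differentiableAt_of_contDiffOn hW hq), smul_add, arcCov, arcCov]

lemma arcCov_smul {f : F → ℝ} {V : F → E} (hf : ContDiffOn ℝ ∞ f Ω) (hV : ContDiffOn ℝ ∞ V Ω)
    (hq : q ∈ Ω) : arcCov G x e (fun q => f q • V q) q =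
      arcDeriv G x e f q • V q + f q • arcCov G x e V q := by
  rw [arcCov, covAlong_smul (h.differentiableAt_of_contDiffOn hf hq)
    (h.differentiableAt_of_contDiffOn hV hq), smul_add, smul_smul, smul_comm, arcCov, arcDeriv]

lemma arcCov_congr {V W : F → E} (hVW : Set.EqOn V W Ω) (hq : q ∈ Ω) :
    arcCov G x e V q = arcCov G x e W q := by
  rw [arcCov, arcCov, covAlong_congr (hVW.eventuallyEq_of_mem (h.eventually_mem hq))]

variable [FiniteDimensional ℝ E]

lemma fderiv_metric {V W : F → E} (hV : ContDiffOn ℝ ∞ V Ω) (hW : ContDiffOn ℝ ∞ W Ω)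
    (hq : q ∈ Ω) (e' : F) :
    fderiv ℝ (fun q => G (x q) (V q) (W q)) q e' =
      G (x q) (covAlong G x e' V q) (W q) + G (x q) (V q) (covAlong G x e' W q) :=
  fderiv_metric_apply h.metric (h.differentiableAt_of_contDiffOn h.smooth hq) (h.mapsTo hq)
    (h.differentiableAt_of_contDiffOn hV hq) (h.differentiableAt_of_contDiffOn hW hq) e'

lemma arcDeriv_metric {V W : F → E} (hV : ContDiffOn ℝ ∞ V Ω) (hW : ContDiffOn ℝ ∞ W Ω)
    (hq : q ∈ Ω) :
    arcDeriv G x e (fun q => G (x q) (V q) (W q)) q =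
      G (x q) (arcCov G x e V q) (W q) + G (x q) (V q) (arcCov G x e W q) := by
  simp only [arcDeriv, arcCov, h.fderiv_metric hV hW hq, map_smul, smul_apply, smul_eq_mul,
    mul_add]

lemma arcDeriv_metric_eq_zero_of_const {V W : F → E} (hV : ContDiffOn ℝ ∞ V Ω)
    (hW : ContDiffOn ℝ ∞ W Ω) {r : ℝ} (hr : ∀ q ∈ Ω, G (x q) (V q) (W q) = r) (hq : q ∈ Ω) :
    G (x q) (arcCov G x e V q) (W q) + G (x q) (V q) (arcCov G x e W q) = 0 := by
  have hconst : (fun q => G (x q) (V q) (W q)) =ᶠ[nhds q] fun _ => r :=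
    (h.eventually_mem hq).mono hr
  rw [← h.arcDeriv_metric hV hW hq, arcDeriv, hconst.fderiv_eq]
  simp

lemma metric_curvature_tangent (hq : q ∈ Ω) :
    G (x q) (chartCurvature G x e q) (chartTangent G x e q) = 0 := by
  have hzero := h.arcDeriv_metric_eq_zero_of_const h.contDiffOn_tangent h.contDiffOn_tangent
    (fun _ hq => h.metric_tangent_tangent hq) hq
  rw [h.metric.symm _ (h.mapsTo hq) (chartTangent G x e q)] at hzero
  exact add_self_eq_zero.1 hzero

lemma metric_arcCov_curvature_tangent (hq : q ∈ Ω) :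
    G (x q) (arcCov G x e (chartCurvature G x e) q) (chartTangent G x e q) =
      -chartCurvatureSq G x e q :=
  eq_neg_of_add_eq_zero_left <| h.arcDeriv_metric_eq_zero_of_const h.contDiffOn_curvature
    h.contDiffOn_tangent (fun _ hq => h.metric_curvature_tangent hq) hq

end Frame

end IsImmersedInChart

end ChartCurve

/-! ### The heat operator along a curve shortening flow in a chart -/

section ChartFlow

variable {E : Type*} [NormedAddCommGroup E] [NormedSpace ℝ E]

/-- The operator `∂/∂t - ∂²/∂s²` along the family of curves `b ↦ x (b, t)`. -/
def chartHeat (G : E → E →L[ℝ] E →L[ℝ] ℝ) (x : ℝ × ℝ → E) (f : ℝ × ℝ → ℝ) (q : ℝ × ℝ) : ℝ :=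
  fderiv ℝ f q (0, 1) - arcDeriv G x (1, 0) (arcDeriv G x (1, 0) f) q

/-- All sectional curvatures of the metric `G` at the point `y` are at most `Ξ`. -/
def LocalSectionalCurvatureLE (G : E → E →L[ℝ] E →L[ℝ] ℝ) (y : E) (Ξ : ℝ) : Prop :=
  ∀ v w, LinearIndependent ℝ ![v, w] →
    G y (riemannCurvature G y v w w) v / (G y v v * G y w w - G y v w ^ 2) ≤ Ξ

lemma LocalSectionalCurvatureLE.apply_riemannCurvature_le {G : E → E →L[ℝ] E →L[ℝ] ℝ} {O : Set E}
    {y : E} {Ξ : ℝ} (hΞ : LocalSectionalCurvatureLE G y Ξ) (hG : IsLocalMetric G O) (hy : y ∈ O)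
    {v w : E} (hv : 0 < G y v v) (hw : G y w w = 1) (hvw : G y v w = 0) :
    G y (riemannCurvature G y v w w) v ≤ Ξ * G y v v := by
  have hwv : G y w v = 0 := (hG.symm y hy w v).trans hvw
  have hindep : LinearIndependent ℝ ![v, w] := by
    refine LinearIndependent.pair_iff.2 fun r s hrs => ?_
    have hleft : G y v (r • v + s • w) = 0 := by rw [hrs, map_zero]
    have hright : G y w (r • v + s • w) = 0 := by rw [hrs, map_zero]
    simp only [map_add, map_smul, smul_eq_mul, hvw, hwv, hw, mul_zero, mul_one, add_zero,
      zero_add] at hleft hright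
    exact ⟨(mul_eq_zero.1 hleft).resolve_right hv.ne', hright⟩
  have hquot := hΞ v w hindep
  rwa [hvw, hw, mul_one, zero_pow two_ne_zero, sub_zero, div_le_iff₀ hv] at hquot

section HeatOperator

variable {G : E → E →L[ℝ] E →L[ℝ] ℝ} {O : Set E} {x : ℝ × ℝ → E} {Ω : Set (ℝ × ℝ)}
  {f f' : ℝ × ℝ → ℝ} {q : ℝ × ℝ} {φ : ℝ → ℝ}

lemma fderiv_comp_snd (hφ : Differentiable ℝ φ) (q e : ℝ × ℝ) :
    fderiv ℝ (fun q : ℝ × ℝ => φ q.2) q e = e.2 * deriv φ q.2 := by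
  have hd : HasFDerivAt (fun q : ℝ × ℝ => φ q.2) _ q :=
    (hφ q.2).hasFDerivAt.comp q hasFDerivAt_snd
  rw [hd.fderiv]
  simp

lemma arcDeriv_comp_snd (hφ : Differentiable ℝ φ) (q : ℝ × ℝ) :
    arcDeriv G x (1, 0) (fun q => φ q.2) q = 0 := by
  simp [arcDeriv, fderiv_comp_snd hφ]

lemma chartHeat_comp_snd (hφ : Differentiable ℝ φ) (q : ℝ × ℝ) :
    chartHeat G x (fun q => φ q.2) q = deriv φ q.2 := by
  have hzero : arcDeriv G x (1, 0) (fun q => φ q.2) = fun _ => 0 := funext (arcDeriv_comp_snd hφ)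
  simp [chartHeat, hzero, fderiv_comp_snd hφ, arcDeriv]

namespace IsImmersedInChart

variable (h : IsImmersedInChart G O x (1, 0) Ω)
include h

lemma chartHeat_sub (hf : ContDiffOn ℝ ∞ f Ω) (hf' : ContDiffOn ℝ ∞ f' Ω) (hq : q ∈ Ω) :
    chartHeat G x (fun q => f q - f' q) q = chartHeat G x f q - chartHeat G x f' q := by
  have hd {f : ℝ × ℝ → ℝ} (hf : ContDiffOn ℝ ∞ f Ω) {q : ℝ × ℝ} (hq : q ∈ Ω) :
      DifferentiableAt ℝ f q := h.differentiableAt_of_contDiffOn hf hq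
  have hfirst : arcDeriv G x (1, 0) (fun q => f q - f' q) =ᶠ[nhds q]
      fun q => arcDeriv G x (1, 0) f q - arcDeriv G x (1, 0) f' q :=
    (h.eventually_mem hq).mono fun q hq => arcDeriv_sub (hd hf hq) (hd hf' hq)
  rw [chartHeat, arcDeriv_congr hfirst,
    arcDeriv_sub (hd (h.contDiffOn_arcDeriv hf) hq) (hd (h.contDiffOn_arcDeriv hf') hq),
    fderiv_fun_sub (hd hf hq) (hd hf' hq), sub_apply, chartHeat, chartHeat]
  ring

lemma chartHeat_mul (hf : ContDiffOn ℝ ∞ f Ω) (hf' : ContDiffOn ℝ ∞ f' Ω) (hq : q ∈ Ω) :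
    chartHeat G x (fun q => f q * f' q) q = chartHeat G x f q * f' q + f q * chartHeat G x f' q -
      2 * (arcDeriv G x (1, 0) f q * arcDeriv G x (1, 0) f' q) := by
  have hd {f : ℝ × ℝ → ℝ} (hf : ContDiffOn ℝ ∞ f Ω) {q : ℝ × ℝ} (hq : q ∈ Ω) :
      DifferentiableAt ℝ f q := h.differentiableAt_of_contDiffOn hf hq
  have hfs := hd (h.contDiffOn_arcDeriv hf) hq
  have hfs' := hd (h.contDiffOn_arcDeriv hf') hq
  have hfirst : arcDeriv G x (1, 0) (fun q => f q * f' q) =ᶠ[nhds q]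
      fun q => arcDeriv G x (1, 0) f q * f' q + f q * arcDeriv G x (1, 0) f' q :=
    (h.eventually_mem hq).mono fun q hq => arcDeriv_mul (hd hf hq) (hd hf' hq)
  rw [chartHeat, arcDeriv_congr hfirst,
    arcDeriv_add (hfs.fun_mul (hd hf' hq)) ((hd hf hq).fun_mul hfs'), arcDeriv_mul hfs (hd hf' hq),
    arcDeriv_mul (hd hf hq) hfs', fderiv_fun_mul (hd hf hq) (hd hf' hq), chartHeat, chartHeat]
  simp only [add_apply, smul_apply, smul_eq_mul]
  ring

lemma differentiableAt_speed (hq : q ∈ Ω) : DifferentiableAt ℝ (chartSpeed G x (1, 0)) q :=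
  h.differentiableAt_of_contDiffOn h.contDiffOn_speed hq

lemma arcDeriv_eq_zero_of_isLocalMaxOn_past (hf : ContDiffOn ℝ ∞ f Ω) (hq : q ∈ Ω)
    (hmax : IsLocalMaxOn f {q' | q'.2 ≤ q.2} q) : arcDeriv G x (1, 0) f q = 0 := by
  rw [arcDeriv, fderiv_space_eq_zero_of_isLocalMaxOn_past hmax
    (h.differentiableAt_of_contDiffOn hf hq), mul_zero]

lemma chartHeat_nonneg_of_isLocalMaxOn_past (hf : ContDiffOn ℝ ∞ f Ω) (hq : q ∈ Ω)
    (hmax : IsLocalMaxOn f {q' | q'.2 ≤ q.2} q) : 0 ≤ chartHeat G x f q := by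
  have hdiff := h.differentiableAt_of_contDiffOn hf hq
  have hf₂ : ContDiffAt ℝ 2 f q := (hf.contDiffAt (h.eventually_mem hq)).of_le (by norm_cast)
  rw [chartHeat, arcDeriv_arcDeriv_of_fderiv_eq_zero (h.differentiableAt_speed hq) (h.speed_pos hq)
    hf₂ (fderiv_space_eq_zero_of_isLocalMaxOn_past hmax hdiff)]
  have hsecond := mul_nonpos_of_nonneg_of_nonpos (sq_nonneg (chartSpeed G x (1, 0) q)⁻¹)
    (fderiv_space_space_nonpos_of_isLocalMaxOn_past hmax hf₂)
  linarith [fderiv_time_nonneg_of_isLocalMaxOn_past hmax hdiff]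

end IsImmersedInChart

end HeatOperator

/-- A curve shortening flow in the chart `(O, G)`: the curves `b ↦ x (b, t)` move with velocity
`DT/∂s`. -/
structure IsChartFlow (G : E → E →L[ℝ] E →L[ℝ] ℝ) (O : Set E) (x : ℝ × ℝ → E)
    (Ω : Set (ℝ × ℝ)) : Prop extends IsImmersedInChart G O x (1, 0) Ω where
  evolution : ∀ q ∈ Ω, fderiv ℝ x q (0, 1) = chartCurvature G x (1, 0) q

namespace IsChartFlow

variable {G : E → E →L[ℝ] E →L[ℝ] ℝ} {O : Set E} {η : E → E →L[ℝ] ℝ} {x : ℝ × ℝ → E}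
  {Ω : Set (ℝ × ℝ)} (h : IsChartFlow G O x Ω) {q : ℝ × ℝ}

local notation "σ" => chartSpeed G x (1, 0)
local notation "T" => chartTangent G x (1, 0)
local notation "κ" => chartCurvature G x (1, 0)
local notation "K" => chartCurvatureSq G x (1, 0)
local notation "∂ₛ" => arcDeriv G x (1, 0)
local notation "Dₛ" => arcCov G x (1, 0)
local notation "Dₜ" => covAlong G x (0, 1)

section

variable [FiniteDimensional ℝ E]
include h

lemma covTime_fderiv (hq : q ∈ Ω) : Dₜ (fun q => fderiv ℝ x q (1, 0)) q = σ q • Dₛ κ q := by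
  have hevol : (fun q => fderiv ℝ x q (0, 1)) =ᶠ[nhds q] κ := (h.eventually_mem hq).mono h.evolution
  rw [covAlong_fderiv_comm h.metric (h.contDiffAt_two hq) (h.mapsTo hq), covAlong_congr hevol,
    h.covAlong_eq_smul_arcCov hq]

lemma fderiv_time_speed (hq : q ∈ Ω) : fderiv ℝ σ q (0, 1) = -(K q * σ q) := by
  have hσ := h.speed_pos hq
  have hsq : (fun q => G (x q) (fderiv ℝ x q (1, 0)) (fderiv ℝ x q (1, 0))) =ᶠ[nhds q]
      fun q => σ q ^ 2 := (h.eventually_mem hq).mono fun _ hq => h.metric_fderiv_fderiv hq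
  have hderiv := h.fderiv_metric h.contDiffOn_fderiv h.contDiffOn_fderiv hq (0, 1)
  rw [hsq.fderiv_eq, fderiv_fun_pow 2 (h.differentiableAt_speed hq),
    h.metric.symm _ (h.mapsTo hq) (fderiv ℝ x q (1, 0)), h.covTime_fderiv hq,
    h.fderiv_eq_smul_tangent hq] at hderiv
  simp only [map_smul, smul_apply, smul_eq_mul, h.metric_arcCov_curvature_tangent hq] at hderiv
  refine mul_left_cancel₀ (mul_pos two_pos hσ).ne' ?_
  norm_num at hderiv
  linarith

lemma covTime_tangent (hq : q ∈ Ω) : Dₜ T q = Dₛ κ q + K q • T q := by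
  have hfactor : (fun q => fderiv ℝ x q (1, 0)) =ᶠ[nhds q] fun q => σ q • T q :=
    (h.eventually_mem hq).mono fun _ hq => h.fderiv_eq_smul_tangent hq
  have hcov := h.covTime_fderiv hq
  rw [covAlong_congr hfactor, covAlong_smul (h.differentiableAt_speed hq)
    (h.differentiableAt_of_contDiffOn h.contDiffOn_tangent hq), h.fderiv_time_speed hq] at hcov
  refine smul_right_injective E (h.speed_pos hq).ne' ?_
  simp only [smul_add, ← hcov]
  module

lemma covTime_arcCov {V : ℝ × ℝ → E} (hV : ContDiffOn ℝ ∞ V Ω) (hq : q ∈ Ω) :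
    Dₜ (Dₛ V) q =
      Dₛ (Dₜ V) q + K q • Dₛ V q + riemannCurvature G (x q) (κ q) (T q) (V q) := by
  have hfactor : covAlong G x (1, 0) V =ᶠ[nhds q] fun q => σ q • Dₛ V q :=
    (h.eventually_mem hq).mono fun _ hq => h.covAlong_eq_smul_arcCov hq V
  have hV₂ : ContDiffAt ℝ 2 V q := (hV.contDiffAt (h.eventually_mem hq)).of_le (by norm_cast)
  have hcomm := covAlong_covAlong_sub h.metric (h.contDiffAt_two hq) (h.mapsTo hq) hV₂
    (0, 1) (1, 0)
  rw [covAlong_congr hfactor, covAlong_smul (h.differentiableAt_speed hq)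
    (h.differentiableAt_of_contDiffOn (h.contDiffOn_arcCov hV) hq), h.fderiv_time_speed hq,
    h.covAlong_eq_smul_arcCov hq (Dₜ V), h.evolution q hq, h.fderiv_eq_smul_tangent hq,
    h.metric.riemannCurvature_smul_snd (h.mapsTo hq)] at hcomm
  refine smul_right_injective E (h.speed_pos hq).ne' ?_
  simp only [smul_add, ← hcomm]
  module

lemma covTime_curvature (hq : q ∈ Ω) :
    Dₜ κ q = Dₛ (Dₛ κ) q + ∂ₛ K q • T q + (2 * K q) • κ q +
      riemannCurvature G (x q) (κ q) (T q) (T q) := by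
  have hDκ := h.contDiffOn_arcCov h.contDiffOn_curvature
  have hKT : ContDiffOn ℝ ∞ (fun q => K q • T q) Ω :=
    h.contDiffOn_curvatureSq.smul h.contDiffOn_tangent
  have hspace : Dₛ (Dₜ T) q = Dₛ (Dₛ κ) q + (∂ₛ K q • T q + K q • κ q) := by
    rw [h.arcCov_congr (fun _ hq => h.covTime_tangent hq) hq, h.arcCov_add hDκ hKT hq,
      h.arcCov_smul h.contDiffOn_curvatureSq h.contDiffOn_tangent hq, chartCurvature]
  rw [chartCurvature, h.covTime_arcCov h.contDiffOn_tangent hq, hspace, chartCurvature]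
  module

lemma chartHeat_form_tangent (hη : IsLocalParallelForm G η O) (hq : q ∈ Ω) :
    chartHeat G x (fun q => η (x q) (T q)) q = K q * η (x q) (T q) := by
  have htime : fderiv ℝ (fun q => η (x q) (T q)) q (0, 1) = η (x q) (Dₜ T q) :=
    fderiv_parallelForm_apply h.metric.isOpen hη (h.differentiableAt_of_contDiffOn h.smooth hq)
      (h.mapsTo hq) (h.differentiableAt_of_contDiffOn h.contDiffOn_tangent hq) (0, 1)
  have hspace : ∂ₛ (fun q => η (x q) (T q)) =ᶠ[nhds q] fun q => η (x q) (κ q) :=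
    (h.eventually_mem hq).mono fun _ hq => h.arcDeriv_form hη h.contDiffOn_tangent hq
  rw [chartHeat, htime, h.covTime_tangent hq, arcDeriv_congr hspace,
    h.arcDeriv_form hη h.contDiffOn_curvature hq, map_add, map_smul, smul_eq_mul,
    add_sub_cancel_left]

lemma arcDeriv_curvatureSq (hq : q ∈ Ω) : ∂ₛ K q = 2 * G (x q) (Dₛ κ q) (κ q) := by
  have hderiv := h.arcDeriv_metric h.contDiffOn_curvature h.contDiffOn_curvature hq
  rwa [h.metric.symm _ (h.mapsTo hq) (κ q), ← two_mul] at hderiv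

lemma chartHeat_curvatureSq (hq : q ∈ Ω) :
    chartHeat G x K q = -(2 * G (x q) (Dₛ κ q) (Dₛ κ q)) + 4 * K q ^ 2 +
      2 * G (x q) (riemannCurvature G (x q) (κ q) (T q) (T q)) (κ q) := by
  have hDκ := h.contDiffOn_arcCov h.contDiffOn_curvature
  have htime : fderiv ℝ K q (0, 1) = 2 * G (x q) (Dₜ κ q) (κ q) := by
    have hderiv := h.fderiv_metric h.contDiffOn_curvature h.contDiffOn_curvature hq (0, 1)
    rwa [h.metric.symm _ (h.mapsTo hq) (κ q), ← two_mul] at hderiv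
  have hspace : ∂ₛ (∂ₛ K) q =
      2 * (G (x q) (Dₛ (Dₛ κ) q) (κ q) + G (x q) (Dₛ κ q) (Dₛ κ q)) := by
    rw [arcDeriv_congr ((h.eventually_mem hq).mono fun _ hq => h.arcDeriv_curvatureSq hq),
      arcDeriv_const_mul (h.differentiableAt_of_contDiffOn
        (h.contDiffOn_metric hDκ h.contDiffOn_curvature) hq),
      h.arcDeriv_metric hDκ h.contDiffOn_curvature hq]
  rw [chartHeat, htime, hspace, h.covTime_curvature hq]
  simp only [map_add, map_smul, add_apply, smul_apply, smul_eq_mul,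
    h.metric.symm _ (h.mapsTo hq) (T q) (κ q), h.metric_curvature_tangent hq]
  rw [chartCurvatureSq]
  ring

theorem not_isLocalMaxOn_exp_sub_form (hη : IsLocalParallelForm G η O) (hq : q ∈ Ω) {δ : ℝ}
    (hδ : 0 < δ) (hzero : δ * Real.exp (-q.2) - η (x q) (T q) = 0) :
    ¬IsLocalMaxOn (fun q => δ * Real.exp (-q.2) - η (x q) (T q)) {q' | q'.2 ≤ q.2} q := by
  intro hmax
  have hφ (t : ℝ) : HasDerivAt (fun t => δ * Real.exp (-t)) (-(δ * Real.exp (-t))) t := by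
    simpa using ((hasDerivAt_neg t).exp).const_mul δ
  have hφ_smooth : ContDiffOn ℝ ∞ (fun q : ℝ × ℝ => δ * Real.exp (-q.2)) Ω := by fun_prop
  have hu_smooth : ContDiffOn ℝ ∞ (fun q => η (x q) (T q)) Ω :=
    h.contDiffOn_form hη.smooth h.contDiffOn_tangent
  have hheat := h.chartHeat_nonneg_of_isLocalMaxOn_past (hφ_smooth.sub hu_smooth) hq hmax
  rw [h.chartHeat_sub hφ_smooth hu_smooth hq,
    chartHeat_comp_snd (φ := fun t => δ * Real.exp (-t)) fun t => (hφ t).differentiableAt,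
    (hφ q.2).deriv, h.chartHeat_form_tangent hη hq, ← sub_eq_zero.1 hzero] at hheat
  have hpos : 0 < δ * Real.exp (-q.2) := by positivity
  have hK : 0 ≤ K q := h.metric.nonneg (h.mapsTo hq) _
  linarith [mul_nonneg hK hpos.le]

lemma arcDeriv_curvatureSq_sub (hη : IsLocalParallelForm G η O) (hq : q ∈ Ω) {φ : ℝ → ℝ}
    (hφ : ContDiff ℝ ∞ φ) :
    ∂ₛ (fun q => K q - φ q.2 * (η (x q) (T q) * η (x q) (T q))) q =
      2 * G (x q) (Dₛ κ q) (κ q) - 2 * φ q.2 * (η (x q) (T q) * η (x q) (κ q)) := by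
  have hu : ContDiffOn ℝ ∞ (fun q => η (x q) (T q)) Ω :=
    h.contDiffOn_form hη.smooth h.contDiffOn_tangent
  have hφ' : ContDiffOn ℝ ∞ (fun q : ℝ × ℝ => φ q.2) Ω := (hφ.comp contDiff_snd).contDiffOn
  have hd {f : ℝ × ℝ → ℝ} (hf : ContDiffOn ℝ ∞ f Ω) := h.differentiableAt_of_contDiffOn hf hq
  rw [arcDeriv_sub (hd h.contDiffOn_curvatureSq) (hd (hφ'.mul (hu.mul hu))),
    arcDeriv_mul (hd hφ') (hd (hu.mul hu)), arcDeriv_mul (hd hu) (hd hu),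
    arcDeriv_comp_snd (hφ.differentiable (by simp)), h.arcDeriv_form hη h.contDiffOn_tangent hq,
    h.arcDeriv_curvatureSq hq, ← chartCurvature]
  ring

lemma chartHeat_curvatureSq_sub (hη : IsLocalParallelForm G η O) (hq : q ∈ Ω) {φ : ℝ → ℝ}
    (hφ : ContDiff ℝ ∞ φ) :
    chartHeat G x (fun q => K q - φ q.2 * (η (x q) (T q) * η (x q) (T q))) q =
      chartHeat G x K q - deriv φ q.2 * η (x q) (T q) ^ 2 -
        2 * φ q.2 * (K q * η (x q) (T q) ^ 2 - η (x q) (κ q) ^ 2) := by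
  have hu : ContDiffOn ℝ ∞ (fun q => η (x q) (T q)) Ω :=
    h.contDiffOn_form hη.smooth h.contDiffOn_tangent
  have hφ' : ContDiffOn ℝ ∞ (fun q : ℝ × ℝ => φ q.2) Ω := (hφ.comp contDiff_snd).contDiffOn
  have hφd := hφ.differentiable (by simp)
  rw [h.chartHeat_sub h.contDiffOn_curvatureSq (hφ'.mul (hu.mul hu)) hq,
    h.chartHeat_mul hφ' (hu.mul hu) hq, h.chartHeat_mul hu hu hq, chartHeat_comp_snd hφd,
    arcDeriv_comp_snd hφd, h.chartHeat_form_tangent hη hq,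
    h.arcDeriv_form hη h.contDiffOn_tangent hq, ← chartCurvature]
  ring

theorem not_isLocalMaxOn_curvatureSq_sub (hη : IsLocalParallelForm G η O) {Ξ c : ℝ}
    (hΞ : LocalSectionalCurvatureLE G (x q) Ξ) (hc : Ξ < c) (hq : q ∈ Ω) {A : ℝ} (hA : 0 < A)
    (hu : 0 < η (x q) (T q))
    (hzero : K q - A * Real.exp (2 * c * q.2) * (η (x q) (T q) * η (x q) (T q)) = 0) :
    ¬IsLocalMaxOn (fun q => K q - A * Real.exp (2 * c * q.2) * (η (x q) (T q) * η (x q) (T q)))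
      {q' | q'.2 ≤ q.2} q := by
  intro hmax
  set φ : ℝ → ℝ := fun t => A * Real.exp (2 * c * t) with hφ_def
  have hφ : ContDiff ℝ ∞ φ := by fun_prop
  have hφ' : deriv φ q.2 = 2 * c * φ q.2 := by
    have hd := (((hasDerivAt_id q.2).const_mul (2 * c)).exp).const_mul A
    exact hd.deriv.trans (by simp only [hφ_def, id]; ring)
  have hφ_pos : 0 < φ q.2 := by positivity
  have hsmooth : ContDiffOn ℝ ∞ (fun q => K q - φ q.2 * (η (x q) (T q) * η (x q) (T q))) Ω :=
    have hu := h.contDiffOn_form hη.smooth h.contDiffOn_tangent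
    h.contDiffOn_curvatureSq.sub ((hφ.comp contDiff_snd).contDiffOn.mul (hu.mul hu))
  have hspace := h.arcDeriv_eq_zero_of_isLocalMaxOn_past hsmooth hq hmax
  have hheat := h.chartHeat_nonneg_of_isLocalMaxOn_past hsmooth hq hmax
  rw [h.arcDeriv_curvatureSq_sub hη hq hφ] at hspace
  rw [h.chartHeat_curvatureSq_sub hη hq hφ, h.chartHeat_curvatureSq hq, hφ'] at hheat
  have hK : K q = φ q.2 * η (x q) (T q) ^ 2 := by rw [sq]; exact sub_eq_zero.1 hzero
  have hK_pos : 0 < K q := hK ▸ by positivity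
  have hbessel := h.metric.bessel (h.mapsTo hq) (h.metric_tangent_tangent hq) hK_pos
    (h.metric_curvature_tangent hq) (Dₛ κ q)
  rw [h.metric_arcCov_curvature_tangent hq, neg_sq] at hbessel
  have hR := hΞ.apply_riemannCurvature_le h.metric (h.mapsTo hq) hK_pos
    (h.metric_tangent_tangent hq) (h.metric_curvature_tangent hq)
  have hproj : G (x q) (Dₛ κ q) (κ q) ^ 2 / G (x q) (κ q) (κ q) =
      φ q.2 * η (x q) (κ q) ^ 2 := by
    rw [show G (x q) (Dₛ κ q) (κ q) = φ q.2 * (η (x q) (T q) * η (x q) (κ q)) by linarith,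
      ← chartCurvatureSq, hK]
    field_simp
  have hKu : φ q.2 * (K q * η (x q) (T q) ^ 2) = K q ^ 2 := by rw [mul_left_comm, ← hK, sq]
  have hcu : φ q.2 * c * η (x q) (T q) ^ 2 = c * K q := by rw [hK]; ring
  have hgap : 0 < (c - Ξ) * K q := mul_pos (sub_pos.2 hc) hK_pos
  rw [← chartCurvatureSq] at hR
  linarith

end

end IsChartFlow

end ChartFlow

/-! ### Charts of a Riemannian manifold -/

section Charts

variable {E : Type*} [NormedAddCommGroup E] [NormedSpace ℝ E]
  {H : Type*} [TopologicalSpace H] (I : ModelWithCorners ℝ E H)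
  {X : Type*} [TopologicalSpace X] [ChartedSpace H X]

/-- The derivative at `p` of the preferred chart around `x`. -/
def chartDeriv (x p : X) : E →L[ℝ] E := mfderiv I 𝓘(ℝ, E) (extChartAt I x) p

/-- The derivative at `y` of the inverse of the preferred chart around `x`. -/
def chartSymmDeriv (x : X) (y : E) : E →L[ℝ] E := mfderiv 𝓘(ℝ, E) I (extChartAt I x).symm y

/-- The transition map between two preferred charts. -/
def chartTransition (x x' : X) (y : E) : E := extChartAt I x' ((extChartAt I x).symm y)

/-- The metric `g` at `p` as a bilinear form on the model space. -/
def metricAt (g : ∀ x : X, TangentSpace I x →L[ℝ] TangentSpace I x →L[ℝ] ℝ) (p : X) :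
    E →L[ℝ] E →L[ℝ] ℝ := g p

/-- The velocity of a curve as an element of the model space. -/
def modelVelocity (c : ℝ → X) (a : ℝ) : E := velocity I c a

/-- The curvature vector of a curve as an element of the model space. -/
def modelCurvature (g : ∀ x : X, TangentSpace I x →L[ℝ] TangentSpace I x →L[ℝ] ℝ) (c : ℝ → X)
    (a : ℝ) : E := curvatureVector I g c a

/-- The unit tangent vector of a curve as an element of the model space. -/
def modelTangent (g : ∀ x : X, TangentSpace I x →L[ℝ] TangentSpace I x →L[ℝ] ℝ) (c : ℝ → X)
    (a : ℝ) : E := unitTangent I g c a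

lemma modelTangent_eq (g : ∀ x : X, TangentSpace I x →L[ℝ] TangentSpace I x →L[ℝ] ℝ)
    (c : ℝ → X) (a : ℝ) : modelTangent I g c a = (speed I g c a)⁻¹ • modelVelocity I c a := rfl

lemma speed_eq (g : ∀ x : X, TangentSpace I x →L[ℝ] TangentSpace I x →L[ℝ] ℝ) (c : ℝ → X)
    (a : ℝ) : speed I g c a =
      √(metricAt I g (c a) (modelVelocity I c a) (modelVelocity I c a)) := rfl

lemma chartMetric_apply (g : ∀ x : X, TangentSpace I x →L[ℝ] TangentSpace I x →L[ℝ] ℝ)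
    (x : X) (y v w : E) : chartMetric I g x y v w =
      metricAt I g ((extChartAt I x).symm y) (chartSymmDeriv I x y v)
        (chartSymmDeriv I x y w) := rfl

variable [I.Boundaryless] [IsManifold I ∞ X] {I}

lemma chartDeriv_chartSymmDeriv {x : X} {y : E} (hy : y ∈ (extChartAt I x).target) (v : E) :
    chartDeriv I x ((extChartAt I x).symm y) (chartSymmDeriv I x y v) = v := by
  have h := mfderiv_extChartAt_comp_mfderivWithin_extChartAt_symm (I := I) hy
  rw [I.range_eq_univ, mfderivWithin_univ] at h
  exact DFunLike.congr_fun h v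

lemma chartSymmDeriv_chartDeriv {x p : X} (hp : p ∈ (extChartAt I x).source) (v : E) :
    chartSymmDeriv I x (extChartAt I x p) (chartDeriv I x p v) = v := by
  have h := mfderivWithin_extChartAt_symm_comp_mfderiv_extChartAt (I := I)
    ((extChartAt I x).map_source hp)
  rw [I.range_eq_univ, mfderivWithin_univ, (extChartAt I x).left_inv hp] at h
  exact DFunLike.congr_fun h v

lemma chartMetric_chartDeriv (g : ∀ x : X, TangentSpace I x →L[ℝ] TangentSpace I x →L[ℝ] ℝ)
    {x p : X} (hp : p ∈ (extChartAt I x).source) (v w : E) :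
    chartMetric I g x (extChartAt I x p) (chartDeriv I x p v) (chartDeriv I x p w) =
      metricAt I g p v w := by
  rw [chartMetric_apply, chartSymmDeriv_chartDeriv hp, chartSymmDeriv_chartDeriv hp,
    (extChartAt I x).left_inv hp]

lemma mdifferentiableAt_extChartAt_symm {x : X} {y : E} (hy : y ∈ (extChartAt I x).target) :
    MDifferentiableAt 𝓘(ℝ, E) I (extChartAt I x).symm y := by
  have h := mdifferentiableWithinAt_extChartAt_symm (I := I) hy
  rwa [I.range_eq_univ, mdifferentiableWithinAt_univ] at h

omit [I.Boundaryless] in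
lemma mdifferentiableAt_extChartAt_of_mem {x p : X} (hp : p ∈ (extChartAt I x).source) :
    MDifferentiableAt I 𝓘(ℝ, E) (extChartAt I x) p :=
  mdifferentiableAt_extChartAt (by rwa [extChartAt_source] at hp)

omit [I.Boundaryless] in
lemma chartDeriv_mfderivWithin {x : X} {c : ℝ → X} {S : Set ℝ} {a : ℝ}
    (hc : MDifferentiableWithinAt 𝓘(ℝ, ℝ) I c S a) (hS : UniqueDiffWithinAt ℝ S a)
    (hx : c a ∈ (extChartAt I x).source) :
    chartDeriv I x (c a) (mfderivWithin 𝓘(ℝ, ℝ) I c S a (1 : ℝ)) =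
      derivWithin (fun b => extChartAt I x (c b)) S a := by
  have h := mfderiv_comp_mfderivWithin (I := 𝓘(ℝ, ℝ)) (I' := I) (I'' := 𝓘(ℝ, E)) a
    (mdifferentiableAt_extChartAt_of_mem hx) hc hS.uniqueMDiffWithinAt
  rw [mfderivWithin_eq_fderivWithin] at h
  exact (DFunLike.congr_fun h (1 : ℝ)).symm

omit [I.Boundaryless] in
lemma chartDeriv_velocity {x : X} {c : ℝ → X} {a : ℝ}
    (hc : MDifferentiableAt 𝓘(ℝ, ℝ) I c a) (hx : c a ∈ (extChartAt I x).source) :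
    chartDeriv I x (c a) (modelVelocity I c a) = deriv (fun b => extChartAt I x (c b)) a := by
  have h := chartDeriv_mfderivWithin (S := Set.univ) hc.mdifferentiableWithinAt
    uniqueDiffWithinAt_univ hx
  rwa [mfderivWithin_univ, derivWithin_univ] at h

lemma fderiv_chartTransition {x x' : X} {y : E} (hy : y ∈ (extChartAt I x).target)
    (hy' : (extChartAt I x).symm y ∈ (extChartAt I x').source) (v : E) :
    fderiv ℝ (chartTransition I x x') y v =
      chartDeriv I x' ((extChartAt I x).symm y) (chartSymmDeriv I x y v) := by
  have h := mfderiv_comp (I := 𝓘(ℝ, E)) (I' := I) (I'' := 𝓘(ℝ, E)) y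
    (mdifferentiableAt_extChartAt_of_mem hy') (mdifferentiableAt_extChartAt_symm hy)
  rw [mfderiv_eq_fderiv] at h
  exact DFunLike.congr_fun h v

lemma contDiffAt_chartTransition {x x' : X} {y : E} (hy : y ∈ (extChartAt I x).target)
    (hy' : (extChartAt I x).symm y ∈ (extChartAt I x').source) :
    ContDiffAt ℝ ∞ (chartTransition I x x') y := by
  have h1 : ContMDiffAt 𝓘(ℝ, E) I ∞ (extChartAt I x).symm y :=
    (contMDiffOn_extChartAt_symm x).contMDiffAt ((isOpen_extChartAt_target x).mem_nhds hy)
  have h2 : ContMDiffAt I 𝓘(ℝ, E) ∞ (extChartAt I x') ((extChartAt I x).symm y) :=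
    contMDiffAt_extChartAt' (by rwa [extChartAt_source] at hy')
  exact (h2.comp y h1).contDiffAt

lemma fderiv_chartTransition_chartDeriv {x x' p : X} (hp : p ∈ (extChartAt I x).source)
    (hp' : p ∈ (extChartAt I x').source) (v : E) :
    fderiv ℝ (chartTransition I x x') (extChartAt I x p) (chartDeriv I x p v) =
      chartDeriv I x' p v := by
  have h := (extChartAt I x).left_inv hp
  rw [fderiv_chartTransition ((extChartAt I x).map_source hp) (by rwa [h]),
    chartSymmDeriv_chartDeriv hp, h]

/-- `g` is a smooth Riemannian metric: it is symmetric, positive definite, and smooth in charts. -/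
structure IsSmoothMetric (g : ∀ x : X, TangentSpace I x →L[ℝ] TangentSpace I x →L[ℝ] ℝ) :
    Prop where
  symm : ∀ (x : X) (v w : E), metricAt I g x v w = metricAt I g x w v
  pos : ∀ (x : X) (v : E), v ≠ 0 → 0 < metricAt I g x v v
  smooth : ∀ x, ContDiffOn ℝ ∞ (chartMetric I g x) (extChartAt I x).target

variable {g : ∀ x : X, TangentSpace I x →L[ℝ] TangentSpace I x →L[ℝ] ℝ}

lemma IsSmoothMetric.isLocalMetric (hg : IsSmoothMetric g) (x : X) :
    IsLocalMetric (chartMetric I g x) (extChartAt I x).target where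
  isOpen := isOpen_extChartAt_target x
  smooth := hg.smooth x
  symm y _ v w := by
    rw [chartMetric_apply, chartMetric_apply, hg.symm]
  pos y hy v hv := by
    rw [chartMetric_apply]
    refine hg.pos _ _ fun h0 => hv ?_
    rw [← chartDeriv_chartSymmDeriv hy v, h0, map_zero]

omit [I.Boundaryless] [IsManifold I ∞ X] in
lemma IsSmoothMetric.metricAt_self_nonneg (hg : IsSmoothMetric g) (x : X) (v : E) :
    0 ≤ metricAt I g x v v := by
  rcases eq_or_ne v 0 with rfl | hv
  · simp
  · exact (hg.pos x v hv).le

lemma chartMetric_eq_pullback {x x' : X} {y : E} (hy : y ∈ (extChartAt I x).target)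
    (hy' : (extChartAt I x).symm y ∈ (extChartAt I x').source) (v w : E) :
    chartMetric I g x y v w = chartMetric I g x' (chartTransition I x x' y)
      (fderiv ℝ (chartTransition I x x') y v) (fderiv ℝ (chartTransition I x x') y w) := by
  rw [fderiv_chartTransition hy hy', fderiv_chartTransition hy hy', chartTransition,
    chartMetric_chartDeriv g hy', chartMetric_apply]

lemma eventually_mem_transition_source {x x' p : X} (hp : p ∈ (extChartAt I x).source)
    (hp' : p ∈ (extChartAt I x').source) :
    ∀ᶠ y in nhds (extChartAt I x p), y ∈ (extChartAt I x).target ∧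
      (extChartAt I x).symm y ∈ (extChartAt I x').source := by
  have ht := (extChartAt I x).map_source hp
  have h1 := (isOpen_extChartAt_target (I := I) x).mem_nhds ht
  refine Filter.Eventually.and h1 ?_
  have h2 : ContinuousAt (extChartAt I x).symm (extChartAt I x p) :=
    (mdifferentiableAt_extChartAt_symm ht).continuousAt
  refine h2.eventually_mem ?_
  rw [(extChartAt I x).left_inv hp]
  exact (isOpen_extChartAt_source x').mem_nhds hp'

section ChangeOfChart

variable {x x' : X} {c : ℝ → X} {a : ℝ}

omit [I.Boundaryless] in
lemma hasDerivAt_extChartAt_comp (hc : MDifferentiableAt 𝓘(ℝ, ℝ) I c a)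
    (hx : c a ∈ (extChartAt I x).source) :
    HasDerivAt (fun b => extChartAt I x (c b)) (chartDeriv I x (c a) (modelVelocity I c a)) a := by
  rw [chartDeriv_velocity hc hx]
  exact ((mdifferentiableAt_extChartAt_of_mem hx).comp a hc).differentiableAt.hasDerivAt

lemma hasDerivAt_fderiv_chartTransition_comp (hc : MDifferentiableAt 𝓘(ℝ, ℝ) I c a)
    (hx : c a ∈ (extChartAt I x).source) (hx' : c a ∈ (extChartAt I x').source) :
    HasDerivAt (fun b => fderiv ℝ (chartTransition I x x') (extChartAt I x (c b)))
      (fderiv ℝ (fderiv ℝ (chartTransition I x x')) (extChartAt I x (c a))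
        (chartDeriv I x (c a) (modelVelocity I c a))) a := by
  have hφ : ContDiffAt ℝ ∞ (chartTransition I x x') (extChartAt I x (c a)) :=
    contDiffAt_chartTransition ((extChartAt I x).map_source hx)
      (by rwa [(extChartAt I x).left_inv hx])
  have hφ' : DifferentiableAt ℝ (fderiv ℝ (chartTransition I x x')) (extChartAt I x (c a)) :=
    (hφ.fderiv_right (m := 1) (by norm_cast)).differentiableAt (by simp)
  exact hφ'.hasFDerivAt.comp_hasDerivAt a (hasDerivAt_extChartAt_comp hc hx)

lemma hasDerivAt_chartDeriv_of_hasDerivAt (hc : MDifferentiableAt 𝓘(ℝ, ℝ) I c a)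
    (hx : c a ∈ (extChartAt I x).source) (hx' : c a ∈ (extChartAt I x').source)
    {V : ℝ → E} {W : E} (hV : HasDerivAt (fun b => chartDeriv I x (c b) (V b)) W a) :
    HasDerivAt (fun b => chartDeriv I x' (c b) (V b))
      (fderiv ℝ (fderiv ℝ (chartTransition I x x')) (extChartAt I x (c a))
          (chartDeriv I x (c a) (modelVelocity I c a)) (chartDeriv I x (c a) (V a)) +
        fderiv ℝ (chartTransition I x x') (extChartAt I x (c a)) W) a := by
  refine ((hasDerivAt_fderiv_chartTransition_comp hc hx hx').clm_apply hV).congr_of_eventuallyEq ?_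
  filter_upwards [hc.continuousAt.eventually_mem ((isOpen_extChartAt_source x).mem_nhds hx),
    hc.continuousAt.eventually_mem ((isOpen_extChartAt_source x').mem_nhds hx')] with b hb hb'
  exact (fderiv_chartTransition_chartDeriv hb hb' _).symm

lemma surjective_fderiv_chartTransition {p : X} (hx : p ∈ (extChartAt I x).source)
    (hx' : p ∈ (extChartAt I x').source) :
    Function.Surjective (fderiv ℝ (chartTransition I x x') (extChartAt I x p)) := by
  intro w
  refine ⟨chartDeriv I x p (chartSymmDeriv I x' (extChartAt I x' p) w), ?_⟩
  have h := chartDeriv_chartSymmDeriv ((extChartAt I x').map_source hx') w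
  rwa [fderiv_chartTransition_chartDeriv hx hx', ← (extChartAt I x').left_inv hx',
    (extChartAt I x').right_inv ((extChartAt I x').map_source hx')]

lemma IsSmoothMetric.fderiv_chartTransition_christoffel [FiniteDimensional ℝ E]
    (hg : IsSmoothMetric g) {p : X} (hx : p ∈ (extChartAt I x).source)
    (hx' : p ∈ (extChartAt I x').source) (v w : E) :
    fderiv ℝ (chartTransition I x x') (extChartAt I x p)
        (christoffel (chartMetric I g x) (extChartAt I x p) v w) =
      christoffel (chartMetric I g x') (extChartAt I x' p)
          (fderiv ℝ (chartTransition I x x') (extChartAt I x p) v)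
          (fderiv ℝ (chartTransition I x x') (extChartAt I x p) w) +
        fderiv ℝ (fderiv ℝ (chartTransition I x x')) (extChartAt I x p) v w := by
  have hp := (extChartAt I x).left_inv hx
  have hφ : chartTransition I x x' (extChartAt I x p) = extChartAt I x' p := by
    rw [chartTransition, hp]
  have ht := (extChartAt I x).map_source hx
  rw [(hg.isLocalMetric x').fderiv_christoffel_of_pullback (hg.isLocalMetric x) ht
    (by rw [hφ]; exact (extChartAt I x').map_source hx')
    ((contDiffAt_chartTransition ht (by rwa [hp])).of_le (by norm_cast))
    (surjective_fderiv_chartTransition hx hx')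
    ((eventually_mem_transition_source hx hx').mono fun y hy v w =>
      chartMetric_eq_pullback hy.1 hy.2 v w), hφ]

end ChangeOfChart

lemma chartDeriv_covDerivAlong [FiniteDimensional ℝ E] (hg : IsSmoothMetric g) {x : X}
    {c : ℝ → X} {a : ℝ} (hc : MDifferentiableAt 𝓘(ℝ, ℝ) I c a)
    (hx : c a ∈ (extChartAt I x).source) {V : ℝ → E}
    (hV : DifferentiableAt ℝ (fun b => chartDeriv I x (c b) (V b)) a) :
    chartDeriv I x (c a) (covDerivAlong I g c V a) =
      deriv (fun b => chartDeriv I x (c b) (V b)) a +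
        christoffel (chartMetric I g x) (extChartAt I x (c a))
          (deriv (fun b => extChartAt I x (c b)) a) (chartDeriv I x (c a) (V a)) := by
  have hx₀ := mem_extChartAt_source (I := I) (c a)
  have hinv := (extChartAt I (c a)).left_inv hx₀
  have hcov : covDerivAlong I g c V a = chartSymmDeriv I (c a) (extChartAt I (c a) (c a))
      (deriv (fun b => chartDeriv I (c a) (c b) (V b)) a +
        christoffel (chartMetric I g (c a)) (extChartAt I (c a) (c a))
          (deriv (fun b => extChartAt I (c a) (c b)) a) (chartDeriv I (c a) (c a) (V a))) := rfl
  have htransition := fderiv_chartTransition (I := I) (x := c a) (x' := x)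
    ((extChartAt I (c a)).map_source hx₀) (by rwa [hinv])
  rw [hinv] at htransition
  have hV₀ := (hasDerivAt_chartDeriv_of_hasDerivAt hc hx hx₀ hV.hasDerivAt).differentiableAt
  rw [hcov, ← htransition, map_add, hg.fderiv_chartTransition_christoffel hx₀ hx,
    (hasDerivAt_extChartAt_comp hc hx₀).deriv, (hasDerivAt_extChartAt_comp hc hx).deriv,
    (hasDerivAt_chartDeriv_of_hasDerivAt hc hx₀ hx hV₀.hasDerivAt).deriv,
    fderiv_chartTransition_chartDeriv hx₀ hx, fderiv_chartTransition_chartDeriv hx₀ hx]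
  abel

lemma chartDeriv_modelCurvature [FiniteDimensional ℝ E] (hg : IsSmoothMetric g) {x : X}
    {c : ℝ → X} {a : ℝ} (hc : MDifferentiableAt 𝓘(ℝ, ℝ) I c a)
    (hx : c a ∈ (extChartAt I x).source)
    (hT : DifferentiableAt ℝ (fun b => chartDeriv I x (c b) (modelTangent I g c b)) a) :
    chartDeriv I x (c a) (modelCurvature I g c a) = (speed I g c a)⁻¹ •
      (deriv (fun b => chartDeriv I x (c b) (modelTangent I g c b)) a +
        christoffel (chartMetric I g x) (extChartAt I x (c a))
          (deriv (fun b => extChartAt I x (c b)) a)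
          (chartDeriv I x (c a) (modelTangent I g c a))) := by
  rw [← chartDeriv_covDerivAlong hg hc hx hT]
  exact (chartDeriv I x (c a)).map_smul (speed I g c a)⁻¹
    (covDerivAlong I g c (modelTangent I g c) a)

section BundleMetric

lemma contMDiffOn_chartSymmDeriv (x : X) (v : E) :
    ContMDiffOn 𝓘(ℝ, E) I.tangent ∞
      (fun y => (⟨(extChartAt I x).symm y, chartSymmDeriv I x y v⟩ : TangentBundle I X))
      (extChartAt I x).target := by
  have hopen := isOpen_extChartAt_target (I := I) x
  have htangent := (contMDiffOn_extChartAt_symm (I := I) (n := ∞) x).contMDiffOn_tangentMapWithin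
    (m := ∞) (by simp) hopen.uniqueMDiffOn
  have hconst : ContMDiff 𝓘(ℝ, E) 𝓘(ℝ, E).tangent ∞
      (fun y => (⟨y, v⟩ : TangentBundle 𝓘(ℝ, E) E)) :=
    contMDiff_vectorSpace_iff_contDiff.2 contDiff_const
  refine (htangent.comp hconst.contMDiffOn fun y hy => hy).congr fun y hy => ?_
  simp only [tangentMapWithin, Function.comp, mfderivWithin_of_isOpen hopen hy]
  rfl

variable [FiniteDimensional ℝ E]
  (g : Bundle.ContMDiffRiemannianMetric I ∞ E (fun x : X => TangentSpace I x))

lemma contDiffOn_chartMetric_inner (x : X) :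
    ContDiffOn ℝ ∞ (chartMetric I g.inner x) (extChartAt I x).target := by
  refine contDiffOn_clm_apply.2 fun v => contDiffOn_clm_apply.2 fun w => ?_
  rw [← contMDiffOn_iff_contDiffOn]
  intro y hy
  have hsymm := contMDiffOn_extChartAt_symm (I := I) (n := ∞) x y hy
  have htotal : ContMDiffWithinAt 𝓘(ℝ, E) (I.prod 𝓘(ℝ)) ∞
      (fun y => Bundle.TotalSpace.mk' ℝ (E := Bundle.Trivial X ℝ) ((extChartAt I x).symm y)
        (g.inner ((extChartAt I x).symm y) (chartSymmDeriv I x y v) (chartSymmDeriv I x y w)))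
      (extChartAt I x).target y :=
    ContMDiffWithinAt.clm_bundle_apply₂ (F₁ := E) (F₂ := E)
      (g.contMDiff.contMDiffAt.comp_contMDiffWithinAt y hsymm)
      (contMDiffOn_chartSymmDeriv x v y hy) (contMDiffOn_chartSymmDeriv x w y hy)
  rw [Bundle.contMDiffWithinAt_totalSpace] at htotal
  exact htotal.2

lemma isSmoothMetric_inner : IsSmoothMetric (I := I) g.inner where
  symm := g.symm
  pos := g.pos
  smooth := contDiffOn_chartMetric_inner g

end BundleMetric

end Charts

/-! ### Curves in a Riemannian manifold -/

section ManifoldCurve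

variable {E : Type*} [NormedAddCommGroup E] [NormedSpace ℝ E]
  {H : Type*} [TopologicalSpace H] (I : ModelWithCorners ℝ E H)
  {X : Type*} [TopologicalSpace X] [ChartedSpace H X]
  (g : ∀ x : X, TangentSpace I x →L[ℝ] TangentSpace I x →L[ℝ] ℝ) (θ : X → E →L[ℝ] ℝ)

/-- The squared curvature `|DT/∂s|²` of a curve. -/
def curvatureSq (c : ℝ → X) (a : ℝ) : ℝ :=
  metricAt I g (c a) (modelCurvature I g c a) (modelCurvature I g c a)

/-- The value `θ(T)` of the one-form `θ` on the unit tangent vector of a curve. -/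
def formTangent (c : ℝ → X) (a : ℝ) : ℝ := θ (c a) (modelTangent I g c a)

/-- The one-form `θ` in the preferred chart around `x`. -/
def chartForm (x : X) (y : E) : E →L[ℝ] ℝ :=
  (θ ((extChartAt I x).symm y)).comp (chartSymmDeriv I x y)

/-- `θ` is a smooth one-form that is parallel for the Levi-Civita connection of `g`. -/
def IsParallelForm : Prop :=
  ∀ x, IsLocalParallelForm (chartMetric I g x) (chartForm I θ x) (extChartAt I x).target

/-- In the preferred chart around `x`, the curve `c` is `b ↦ f (ℓ b)` as long as `ℓ b ∈ Ω`; here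
`ℓ` is a line in the direction `e`. Lines in `F = ℝ × ℝ` single out the curves of a family. -/
structure IsCurveInChart {F : Type*} [NormedAddCommGroup F] [NormedSpace ℝ F] (x : X) (c : ℝ → X)
    (f : F → E) (e : F) (ℓ : ℝ → F) (Ω : Set F) : Prop where
  mdifferentiable : MDifferentiable 𝓘(ℝ, ℝ) I c
  hasDerivAt : ∀ b, HasDerivAt ℓ e b
  mem_source : ∀ b, ℓ b ∈ Ω → c b ∈ (extChartAt I x).source
  eq_chart : ∀ b, ℓ b ∈ Ω → f (ℓ b) = extChartAt I x (c b)

variable {I g θ}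

section Periodic

variable {c : ℝ → X} {h : ℝ}

lemma modelVelocity_periodic (hc : MDifferentiable 𝓘(ℝ, ℝ) I c) (hper : Function.Periodic c h) :
    Function.Periodic (modelVelocity I c) h := by
  intro a
  have hshift : HasFDerivAt (fun b : ℝ => b + h) (ContinuousLinearMap.id ℝ ℝ) a :=
    (hasFDerivAt_id a).add_const h
  have hcomp := ((hc (a + h)).hasMFDerivAt.comp a hshift.hasMFDerivAt).mfderiv
  have hcongr (c' : ℝ → X) (hc' : c' = c) : modelVelocity I c' a = modelVelocity I c a := by
    rw [hc']
  rw [← hcongr _ (funext hper : c ∘ (fun b => b + h) = c)]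
  exact (DFunLike.congr_fun hcomp (1 : ℝ)).symm

lemma speed_periodic (hc : MDifferentiable 𝓘(ℝ, ℝ) I c) (hper : Function.Periodic c h) :
    Function.Periodic (speed I g c) h := fun a => by
  rw [speed_eq, speed_eq, modelVelocity_periodic hc hper, hper]

lemma modelTangent_periodic (hc : MDifferentiable 𝓘(ℝ, ℝ) I c) (hper : Function.Periodic c h) :
    Function.Periodic (modelTangent I g c) h := fun a => by
  rw [modelTangent_eq, modelTangent_eq, modelVelocity_periodic hc hper, speed_periodic hc hper]

lemma modelCurvature_eq (c : ℝ → X) (a : ℝ) :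
    modelCurvature I g c a = (speed I g c a)⁻¹ • chartSymmDeriv I (c a) (extChartAt I (c a) (c a))
      (deriv (fun b => chartDeriv I (c a) (c b) (modelTangent I g c b)) a +
        christoffel (chartMetric I g (c a)) (extChartAt I (c a) (c a))
          (deriv (fun b => extChartAt I (c a) (c b)) a)
          (chartDeriv I (c a) (c a) (modelTangent I g c a))) := rfl

lemma modelCurvature_periodic (hc : MDifferentiable 𝓘(ℝ, ℝ) I c) (hper : Function.Periodic c h) :
    Function.Periodic (modelCurvature I g c) h := fun a => by
  have hT := modelTangent_periodic (g := g) hc hper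
  rw [modelCurvature_eq, modelCurvature_eq, hper, speed_periodic hc hper, hT a,
    ← deriv_comp_add_const, ← deriv_comp_add_const]
  simp only [hT _, hper _]

lemma curvatureSq_periodic (hc : MDifferentiable 𝓘(ℝ, ℝ) I c) (hper : Function.Periodic c h) :
    Function.Periodic (curvatureSq I g c) h := fun a => by
  rw [curvatureSq, curvatureSq, modelCurvature_periodic hc hper, hper]

lemma formTangent_periodic (hc : MDifferentiable 𝓘(ℝ, ℝ) I c) (hper : Function.Periodic c h) :
    Function.Periodic (formTangent I g θ c) h := fun a => by
  rw [formTangent, formTangent, modelTangent_periodic hc hper, hper]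

end Periodic

omit [TopologicalSpace X] in
lemma angular_periodic (γ : Circle → X) : Function.Periodic (angular γ) (2 * Real.pi) := fun a => by
  simp only [angular, Circle.periodic_exp a]

lemma IsImmersedCurve.contMDiff_angular {γ : Circle → X} (hγ : IsImmersedCurve I γ) :
    ContMDiff 𝓘(ℝ, ℝ) I ∞ (angular γ) :=
  hγ.1.comp contMDiff_circleExp

lemma IsImmersedCurve.mdifferentiable_angular {γ : Circle → X} (hγ : IsImmersedCurve I γ) :
    MDifferentiable 𝓘(ℝ, ℝ) I (angular γ) :=
  hγ.contMDiff_angular.mdifferentiable (by simp)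

lemma IsSmoothMetric.curvatureSq_nonneg (hg : IsSmoothMetric g) (c : ℝ → X) (a : ℝ) :
    0 ≤ curvatureSq I g c a :=
  hg.metricAt_self_nonneg _ _

lemma IsSmoothMetric.formTangent_sq_le_one (hg : IsSmoothMetric g)
    (hle : ∀ p v, θ p v ^ 2 ≤ metricAt I g p v v) {c : ℝ → X} {a : ℝ} (hc : velocity I c a ≠ 0) :
    formTangent I g θ c a ^ 2 ≤ 1 := by
  have hpos : 0 < metricAt I g (c a) (modelVelocity I c a) (modelVelocity I c a) := hg.pos _ _ hc
  rw [formTangent, modelTangent_eq, map_smul, smul_eq_mul, mul_pow, inv_pow, speed_eq,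
    Real.sq_sqrt hpos.le, inv_mul_le_one₀ hpos]
  exact hle _ _

lemma curvatureSq_eq_sq_of_eq_smul {c : ℝ → X} {a κ : ℝ} {ν : E}
    (hν : metricAt I g (c a) ν ν = 1) (hcurv : modelCurvature I g c a = κ • ν) :
    curvatureSq I g c a = κ ^ 2 := by
  simp only [curvatureSq, hcurv, map_smul, smul_apply, hν, smul_eq_mul, mul_one, sq]

lemma IsSignedCurvature.sq_eq {γ : Circle → X} {k : Circle → ℝ} (hk : IsSignedCurvature I g γ k)
    (a : ℝ) : k (Circle.exp a) ^ 2 = curvatureSq I g (angular γ) a := by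
  obtain ⟨-, N, hN, -, hcurv⟩ := hk
  exact (curvatureSq_eq_sq_of_eq_smul (E := E) (hN (Circle.exp a)) (hcurv a)).symm

variable [I.Boundaryless] [IsManifold I ∞ X]

lemma chartForm_chartDeriv {x p : X} (hp : p ∈ (extChartAt I x).source) (v : E) :
    chartForm I θ x (extChartAt I x p) (chartDeriv I x p v) = θ p v := by
  rw [chartForm, ContinuousLinearMap.comp_apply, chartSymmDeriv_chartDeriv hp,
    (extChartAt I x).left_inv hp]

lemma chartDeriv_ne_zero {x p : X} (hp : p ∈ (extChartAt I x).source) {v : E} (hv : v ≠ 0) :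
    chartDeriv I x p v ≠ 0 := fun h0 => hv <| by
  rw [← chartSymmDeriv_chartDeriv hp v, h0, map_zero]

omit [I.Boundaryless] in
lemma contMDiffOn_extChartAt_source (x : X) :
    ContMDiffOn I 𝓘(ℝ, E) ∞ (extChartAt I x) (extChartAt I x).source := by
  rw [extChartAt_source]
  exact contMDiffOn_extChartAt

lemma chartDeriv_chartSymmDeriv_self (x : X) (v : E) :
    chartDeriv I x x (chartSymmDeriv I x (extChartAt I x x) v) = v := by
  simpa only [extChartAt_to_inv] using
    chartDeriv_chartSymmDeriv (I := I) (mem_extChartAt_target x) v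

lemma sectionalCurvature_eq (x : X) (v w : E) :
    sectionalCurvature I g x (chartSymmDeriv I x (extChartAt I x x) v)
        (chartSymmDeriv I x (extChartAt I x x) w) =
      chartMetric I g x (extChartAt I x x)
          (riemannCurvature (chartMetric I g x) (extChartAt I x x) v w w) v /
        (chartMetric I g x (extChartAt I x x) v v * chartMetric I g x (extChartAt I x x) w w -
          chartMetric I g x (extChartAt I x x) v w ^ 2) := by
  have h : ∀ v' w' : E, sectionalCurvature I g x v' w' =
      chartMetric I g x (extChartAt I x x) (riemannCurvature (chartMetric I g x) (extChartAt I x x)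
        (chartDeriv I x x v') (chartDeriv I x x w') (chartDeriv I x x w')) (chartDeriv I x x v') /
      (chartMetric I g x (extChartAt I x x) (chartDeriv I x x v') (chartDeriv I x x v') *
        chartMetric I g x (extChartAt I x x) (chartDeriv I x x w') (chartDeriv I x x w') -
        chartMetric I g x (extChartAt I x x) (chartDeriv I x x v') (chartDeriv I x x w') ^ 2) :=
    fun _ _ => rfl
  rw [h, chartDeriv_chartSymmDeriv_self, chartDeriv_chartSymmDeriv_self]

lemma SectionalCurvatureLE.localSectionalCurvatureLE {Ξ : ℝ} (hΞ : SectionalCurvatureLE I g Ξ)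
    (x : X) : LocalSectionalCurvatureLE (chartMetric I g x) (extChartAt I x x) Ξ := by
  intro v w hvw
  rw [← sectionalCurvature_eq]
  refine hΞ x _ _ (LinearIndependent.of_comp (chartDeriv I x x).toLinearMap ?_)
  convert hvw using 1
  ext i
  fin_cases i
  exacts [chartDeriv_chartSymmDeriv_self x v, chartDeriv_chartSymmDeriv_self x w]

namespace IsCurveInChart

variable {F : Type*} [NormedAddCommGroup F] [NormedSpace ℝ F] {x : X} {c : ℝ → X} {f : F → E}
  {e : F} {ℓ : ℝ → F} {Ω : Set F} (h : IsCurveInChart I x c f e ℓ Ω) {a : ℝ}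
include h

omit [I.Boundaryless] in
lemma fderiv_eq (hΩ : IsOpen Ω) (hf : DifferentiableAt ℝ f (ℓ a)) (ha : ℓ a ∈ Ω) :
    fderiv ℝ f (ℓ a) e = chartDeriv I x (c a) (modelVelocity I c a) := by
  have hev : (fun b => extChartAt I x (c b)) =ᶠ[nhds a] fun b => f (ℓ b) :=
    ((h.hasDerivAt a).continuousAt.eventually_mem (hΩ.mem_nhds ha)).mono fun b hb =>
      (h.eq_chart b hb).symm
  exact (hf.hasFDerivAt.comp_hasDerivAt a (h.hasDerivAt a)).unique
    ((hasDerivAt_extChartAt_comp (h.mdifferentiable a) (h.mem_source a ha)).congr_of_eventuallyEq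
      hev.symm)

variable (hf : IsImmersedInChart (chartMetric I g x) (extChartAt I x).target f e Ω)
include hf

lemma chartSpeed_eq (ha : ℓ a ∈ Ω) : chartSpeed (chartMetric I g x) f e (ℓ a) = speed I g c a := by
  rw [chartSpeed, h.fderiv_eq hf.isOpen (hf.differentiableAt_of_contDiffOn hf.smooth ha) ha,
    h.eq_chart a ha, chartMetric_chartDeriv g (h.mem_source a ha), speed_eq]

lemma chartTangent_eq (ha : ℓ a ∈ Ω) : chartTangent (chartMetric I g x) f e (ℓ a) =
    chartDeriv I x (c a) (modelTangent I g c a) := by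
  rw [chartTangent, h.chartSpeed_eq hf ha,
    h.fderiv_eq hf.isOpen (hf.differentiableAt_of_contDiffOn hf.smooth ha) ha, modelTangent_eq,
    map_smul]

lemma form_chartTangent_eq (ha : ℓ a ∈ Ω) :
    chartForm I θ x (f (ℓ a)) (chartTangent (chartMetric I g x) f e (ℓ a)) =
      formTangent I g θ c a := by
  rw [h.chartTangent_eq hf ha, h.eq_chart a ha, chartForm_chartDeriv (h.mem_source a ha),
    formTangent]

variable [FiniteDimensional ℝ E] (hg : IsSmoothMetric g)
include hg

lemma chartCurvature_eq (ha : ℓ a ∈ Ω) : chartCurvature (chartMetric I g x) f e (ℓ a) =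
    chartDeriv I x (c a) (modelCurvature I g c a) := by
  have hev := (h.hasDerivAt a).continuousAt.eventually_mem (hf.isOpen.mem_nhds ha)
  have hx : HasDerivAt (fun b => extChartAt I x (c b)) (fderiv ℝ f (ℓ a) e) a :=
    ((hf.differentiableAt_of_contDiffOn hf.smooth ha).hasFDerivAt.comp_hasDerivAt a
      (h.hasDerivAt a)).congr_of_eventuallyEq (hev.mono fun b hb => (h.eq_chart b hb).symm)
  have hT : HasDerivAt (fun b => chartDeriv I x (c b) (modelTangent I g c b))
      (fderiv ℝ (chartTangent (chartMetric I g x) f e) (ℓ a) e) a :=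
    ((hf.differentiableAt_of_contDiffOn hf.contDiffOn_tangent ha).hasFDerivAt.comp_hasDerivAt a
      (h.hasDerivAt a)).congr_of_eventuallyEq
        (hev.mono fun b hb => (h.chartTangent_eq hf hb).symm)
  rw [chartDeriv_modelCurvature hg (h.mdifferentiable a) (h.mem_source a ha)
    hT.differentiableAt, hx.deriv, hT.deriv, ← h.chartSpeed_eq hf ha, ← h.chartTangent_eq hf ha,
    ← h.eq_chart a ha, chartCurvature, arcCov, covAlong]

lemma chartCurvatureSq_eq (ha : ℓ a ∈ Ω) :
    chartCurvatureSq (chartMetric I g x) f e (ℓ a) = curvatureSq I g c a := by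
  rw [chartCurvatureSq, h.chartCurvature_eq hf hg ha, h.eq_chart a ha,
    chartMetric_chartDeriv g (h.mem_source a ha), curvatureSq]

end IsCurveInChart

section Continuity

variable {c : ℝ → X}

omit [I.Boundaryless] [IsManifold I ∞ X] in
lemma isCurveInChart_id (hc : ContMDiff 𝓘(ℝ, ℝ) I ∞ c) (x : X) :
    IsCurveInChart I x c (fun b => extChartAt I x (c b)) 1 id (c ⁻¹' (extChartAt I x).source) where
  mdifferentiable := hc.mdifferentiable (by simp)
  hasDerivAt := hasDerivAt_id
  mem_source _ hb := hb
  eq_chart _ _ := rfl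

lemma isImmersedInChart_of_velocity_ne_zero (hg : IsSmoothMetric g)
    (hc : ContMDiff 𝓘(ℝ, ℝ) I ∞ c) (hc' : ∀ a, velocity I c a ≠ 0) (x : X) :
    IsImmersedInChart (chartMetric I g x) (extChartAt I x).target (fun b => extChartAt I x (c b)) 1
      (c ⁻¹' (extChartAt I x).source) := by
  have hopen : IsOpen (c ⁻¹' (extChartAt I x).source) :=
    (isOpen_extChartAt_source x).preimage hc.continuous
  have hsmooth : ContDiffOn ℝ ∞ (fun b => extChartAt I x (c b)) (c ⁻¹' (extChartAt I x).source) :=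
    ((contMDiffOn_extChartAt_source x).comp hc.contMDiffOn fun _ h => h).contDiffOn
  refine ⟨hg.isLocalMetric x, hopen, hsmooth, fun b hb => (extChartAt I x).map_source hb,
    fun b hb => ?_⟩
  have hvel : fderiv ℝ (fun b => extChartAt I x (c b)) b 1 =
      chartDeriv I x (c b) (modelVelocity I c b) :=
    (isCurveInChart_id hc x).fderiv_eq (a := b) hopen
      (differentiableAt_of_contDiffOn hsmooth (hopen.mem_nhds hb)) hb
  rw [hvel]
  exact chartDeriv_ne_zero hb (hc' b)

lemma continuous_formTangent (hg : IsSmoothMetric g) (hθ : IsParallelForm I g θ)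
    (hc : ContMDiff 𝓘(ℝ, ℝ) I ∞ c) (hc' : ∀ a, velocity I c a ≠ 0) :
    Continuous (formTangent I g θ c) := by
  refine continuous_iff_continuousAt.2 fun a => ?_
  have hf := isImmersedInChart_of_velocity_ne_zero hg hc hc' (c a)
  have ha : a ∈ c ⁻¹' (extChartAt I (c a)).source := mem_extChartAt_source (c a)
  refine ((hf.differentiableAt_of_contDiffOn
    (hf.contDiffOn_form (hθ (c a)).smooth hf.contDiffOn_tangent) ha).continuousAt).congr ?_
  exact (hf.eventually_mem ha).mono fun b hb =>
    (isCurveInChart_id hc (c a)).form_chartTangent_eq (a := b) hf hb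

variable [FiniteDimensional ℝ E]

lemma continuous_curvatureSq (hg : IsSmoothMetric g) (hc : ContMDiff 𝓘(ℝ, ℝ) I ∞ c)
    (hc' : ∀ a, velocity I c a ≠ 0) : Continuous (curvatureSq I g c) := by
  refine continuous_iff_continuousAt.2 fun a => ?_
  have hf := isImmersedInChart_of_velocity_ne_zero hg hc hc' (c a)
  have ha : a ∈ c ⁻¹' (extChartAt I (c a)).source := mem_extChartAt_source (c a)
  refine ((hf.differentiableAt_of_contDiffOn hf.contDiffOn_curvatureSq ha).continuousAt).congr ?_
  exact (hf.eventually_mem ha).mono fun b hb =>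
    (isCurveInChart_id hc (c a)).chartCurvatureSq_eq (a := b) hf hg hb

lemma IsImmersedCurve.exists_curvatureSq_lt_mul_formTangent_sq (hg : IsSmoothMetric g)
    (hθ : IsParallelForm I g θ) {γ : Circle → X} (hγ : IsImmersedCurve I γ)
    (hpos : ∀ a, 0 < formTangent I g θ (angular γ) a) :
    ∃ B > 0, ∀ a, curvatureSq I g (angular γ) a < B * formTangent I g θ (angular γ) a ^ 2 := by
  have hK (a : ℝ) : 0 < curvatureSq I g (angular γ) a + 1 :=
    add_pos_of_nonneg_of_pos (hg.curvatureSq_nonneg _ a) one_pos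
  have hcont : Continuous fun a => formTangent I g θ (angular γ) a ^ 2 /
      (curvatureSq I g (angular γ) a + 1) :=
    ((continuous_formTangent hg hθ hγ.contMDiff_angular hγ.2).pow 2).div
      ((continuous_curvatureSq hg hγ.contMDiff_angular hγ.2).add continuous_const)
      fun a => (hK a).ne'
  have hper : Function.Periodic (fun a => formTangent I g θ (angular γ) a ^ 2 /
      (curvatureSq I g (angular γ) a + 1)) (2 * Real.pi) := fun a => by
    simp only [formTangent_periodic hγ.mdifferentiable_angular (angular_periodic γ) a,
      curvatureSq_periodic hγ.mdifferentiable_angular (angular_periodic γ) a]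
  obtain ⟨δ, hδ, hlt⟩ := exists_pos_forall_lt_of_periodic hcont hper (by positivity)
    fun a => div_pos (pow_pos (hpos a) 2) (hK a)
  refine ⟨δ⁻¹, inv_pos.2 hδ, fun a => ?_⟩
  have hbound := (lt_div_iff₀ (hK a)).1 (hlt a)
  rw [inv_mul_eq_div, lt_div_iff₀' hδ]
  linarith

end Continuity

end ManifoldCurve

/-! ### Curve shortening flow in a Riemannian manifold -/

lemma isOpen_lt_and_coe_lt (τ : EReal) : IsOpen {t : ℝ | 0 < t ∧ (t : EReal) < τ} :=
  (isOpen_lt continuous_const continuous_id).inter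
    (isOpen_lt continuous_coe_real_ereal continuous_const)

lemma Icc_subset_timeInterval {τ : EReal} {t : ℝ} (ht : t ∈ timeInterval τ) :
    Set.Icc 0 t ⊆ timeInterval τ :=
  fun _ hs => ⟨hs.1, lt_of_le_of_lt (by exact_mod_cast hs.2) ht.2⟩

lemma uniqueDiffOn_timeInterval (τ : EReal) : UniqueDiffOn ℝ (timeInterval τ) := by
  intro t ht
  have hconv : Convex ℝ (timeInterval τ) := Set.OrdConnected.convex
    ⟨fun s hs r hr u hu => Icc_subset_timeInterval hr ⟨hs.1.trans hu.1, hu.2⟩⟩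
  obtain ⟨r, htr, hrτ⟩ := EReal.lt_iff_exists_real_btwn.1 ht.2
  refine uniqueDiffOn_convex hconv ⟨r, mem_interior.2 ⟨_, fun s hs => ⟨hs.1.le, hs.2⟩,
    isOpen_lt_and_coe_lt τ, ht.1.trans_lt (by exact_mod_cast htr), hrτ⟩⟩ t ht

lemma isLocalMaxOn_of_forall_le_zero {w : ℝ → ℝ → ℝ} {f : ℝ × ℝ → ℝ} {Ω : Set (ℝ × ℝ)} {a t : ℝ}
    (hΩ : IsOpen Ω) (hpos : ∀ q ∈ Ω, 0 ≤ q.2) (hf : ∀ q ∈ Ω, f q = w q.1 q.2) (hq : (a, t) ∈ Ω)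
    (hzero : w a t = 0) (hle : ∀ b, ∀ s ∈ Set.Icc 0 t, w b s ≤ 0) :
    IsLocalMaxOn f {q | q.2 ≤ t} (a, t) := by
  filter_upwards [mem_nhdsWithin_of_mem_nhds (hΩ.mem_nhds hq), self_mem_nhdsWithin] with q hqΩ hqt
  rw [hf q hqΩ, hf _ hq, hzero]
  exact hle q.1 q.2 ⟨hpos q hqΩ, hqt⟩

section ManifoldFlow

variable {E : Type*} [NormedAddCommGroup E] [NormedSpace ℝ E]
  {H : Type*} [TopologicalSpace H] (I : ModelWithCorners ℝ E H)
  {X : Type*} [TopologicalSpace X] [ChartedSpace H X]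

/-- The flow `γ` in the preferred chart around `x`, as a function of the angle and the time. -/
def chartFamily (γ : Circle → ℝ → X) (x : X) (q : ℝ × ℝ) : E :=
  extChartAt I x (γ (Circle.exp q.1) q.2)

/-- The derivative of `chartFamily`, one-sided in time at `t = 0`. -/
def chartFamilyDeriv (τ : EReal) (γ : Circle → ℝ → X) (x : X) (q : ℝ × ℝ) : ℝ × ℝ →L[ℝ] E :=
  fderivWithin ℝ (chartFamily I γ x) (Set.univ ×ˢ timeInterval τ) q

/-- The angles and positive times for which `γ` is in the domain of the preferred chart around
`x`. -/
def chartDomain (τ : EReal) (γ : Circle → ℝ → X) (x : X) : Set (ℝ × ℝ) :=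
  {q | (0 < q.2 ∧ (q.2 : EReal) < τ) ∧ γ (Circle.exp q.1) q.2 ∈ (extChartAt I x).source}

variable {I} {g : ∀ x : X, TangentSpace I x →L[ℝ] TangentSpace I x →L[ℝ] ℝ} {θ : X → E →L[ℝ] ℝ}
  {τ : EReal} {γ : Circle → ℝ → X} {x : X} {q : ℝ × ℝ}

lemma mem_prod_timeInterval_of_mem_chartDomain (hq : q ∈ chartDomain I τ γ x) :
    q ∈ Set.univ ×ˢ timeInterval τ :=
  ⟨Set.mem_univ _, hq.1.1.le, hq.1.2⟩

namespace IsCurveShorteningFlow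

variable (h : IsCurveShorteningFlow I g τ γ)
include h

lemma contMDiffOn_family : ContMDiffOn 𝓘(ℝ, ℝ × ℝ) I ∞
    (fun q : ℝ × ℝ => γ (Circle.exp q.1) q.2) (Set.univ ×ˢ timeInterval τ) := by
  have hlift : ContMDiff 𝓘(ℝ, ℝ × ℝ) ((𝓡 1).prod 𝓘(ℝ, ℝ)) ∞
      (fun q : ℝ × ℝ => (Circle.exp q.1, q.2)) :=
    (contMDiff_circleExp.comp contDiff_fst.contMDiff).prodMk contDiff_snd.contMDiff
  exact h.smooth.comp hlift.contMDiffOn fun q hq => ⟨Set.mem_univ _, hq.2⟩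

lemma mdifferentiableWithinAt_time {t : ℝ} (ht : t ∈ timeInterval τ) (z : Circle) :
    MDifferentiableWithinAt 𝓘(ℝ, ℝ) I (γ z) (timeInterval τ) t := by
  have hline : ContMDiff 𝓘(ℝ, ℝ) ((𝓡 1).prod 𝓘(ℝ, ℝ)) ∞ (fun s : ℝ => (z, s)) :=
    contMDiff_const.prodMk contMDiff_id
  have hsmooth : ContMDiffOn 𝓘(ℝ, ℝ) I ∞ (γ z) (timeInterval τ) :=
    h.smooth.comp hline.contMDiffOn fun s hs => ⟨Set.mem_univ _, hs⟩
  exact (hsmooth t ht).mdifferentiableWithinAt (by simp)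

lemma isOpen_chartDomain (x : X) : IsOpen (chartDomain I τ γ x) := by
  have hopen : IsOpen {q : ℝ × ℝ | 0 < q.2 ∧ (q.2 : EReal) < τ} :=
    (isOpen_lt_and_coe_lt τ).preimage continuous_snd
  exact (h.contMDiffOn_family.continuousOn.mono fun q hq =>
    ⟨Set.mem_univ _, hq.1.le, hq.2⟩).isOpen_inter_preimage hopen (isOpen_extChartAt_source x)

lemma fderiv_chartFamily (hq : q ∈ chartDomain I τ γ x) :
    fderiv ℝ (chartFamily I γ x) q = chartFamilyDeriv I τ γ x q :=
  (fderivWithin_of_mem_nhds (Filter.mem_of_superset ((h.isOpen_chartDomain x).mem_nhds hq)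
    fun _ => mem_prod_timeInterval_of_mem_chartDomain)).symm

lemma eventually_mem_source (hq : q ∈ Set.univ ×ˢ timeInterval τ) :
    ∀ᶠ q' in nhdsWithin q (Set.univ ×ˢ timeInterval τ),
      γ (Circle.exp q'.1) q'.2 ∈ (extChartAt I (γ (Circle.exp q.1) q.2)).source :=
  h.contMDiffOn_family.continuousOn q hq (extChartAt_source_mem_nhds (I := I) _)

variable [IsManifold I ∞ X]

lemma contDiffWithinAt_chartFamily (hq : q ∈ Set.univ ×ˢ timeInterval τ)
    (hx : γ (Circle.exp q.1) q.2 ∈ (extChartAt I x).source) :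
    ContDiffWithinAt ℝ ∞ (chartFamily I γ x) (Set.univ ×ˢ timeInterval τ) q :=
  ((contMDiffAt_extChartAt' (by rwa [extChartAt_source] at hx)).comp_contMDiffWithinAt q
    (h.contMDiffOn_family q hq)).contDiffWithinAt

lemma chartFamilyDeriv_angle (hq : q ∈ Set.univ ×ˢ timeInterval τ)
    (hx : γ (Circle.exp q.1) q.2 ∈ (extChartAt I x).source) :
    chartFamilyDeriv I τ γ x q (1, 0) =
      chartDeriv I x (γ (Circle.exp q.1) q.2) (modelVelocity I (angular (γ · q.2)) q.1) := by
  have hf := ((h.contDiffWithinAt_chartFamily hq hx).differentiableWithinAt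
    (by simp)).hasFDerivWithinAt
  have hline : HasDerivAt (fun b : ℝ => (b, q.2)) ((1, 0) : ℝ × ℝ) q.1 :=
    (hasDerivAt_id q.1).prodMk (hasDerivAt_const q.1 q.2)
  have hmaps : ∀ᶠ b in nhds q.1, (b, q.2) ∈ (Set.univ : Set ℝ) ×ˢ timeInterval τ :=
    Filter.Eventually.of_forall fun b => ⟨Set.mem_univ b, hq.2⟩
  refine (hf.comp_hasDerivAt_of_eq q.1 hline hmaps rfl).unique ?_
  exact hasDerivAt_extChartAt_comp ((h.immersed _ hq.2).mdifferentiable_angular q.1) hx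

lemma chartFamilyDeriv_time (hq : q ∈ Set.univ ×ˢ timeInterval τ)
    (hx : γ (Circle.exp q.1) q.2 ∈ (extChartAt I x).source) :
    chartFamilyDeriv I τ γ x q (0, 1) =
      chartDeriv I x (γ (Circle.exp q.1) q.2) (modelCurvature I g (angular (γ · q.2)) q.1) := by
  have hf := ((h.contDiffWithinAt_chartFamily hq hx).differentiableWithinAt
    (by simp)).hasFDerivWithinAt
  have hline : HasDerivAt (fun s : ℝ => (q.1, s)) ((0, 1) : ℝ × ℝ) q.2 :=
    (hasDerivAt_const q.2 q.1).prodMk (hasDerivAt_id q.2)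
  have hcurv : modelCurvature I g (angular (γ · q.2)) q.1 =
      mfderivWithin 𝓘(ℝ, ℝ) I (γ (Circle.exp q.1)) (timeInterval τ) q.2 (1 : ℝ) :=
    (h.evolution q.2 hq.2 q.1).symm
  have hunique := uniqueDiffOn_timeInterval τ q.2 hq.2
  rw [hcurv, chartDeriv_mfderivWithin (h.mdifferentiableWithinAt_time hq.2 _) hunique hx]
  have hmaps : Set.MapsTo (fun s : ℝ => (q.1, s)) (timeInterval τ) (Set.univ ×ˢ timeInterval τ) :=
    fun s hs => ⟨Set.mem_univ _, hs⟩
  exact ((hf.comp_hasDerivWithinAt q.2 hline.hasDerivWithinAt hmaps).derivWithin hunique).symm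

omit h [IsManifold I ∞ X] in
lemma isCurveInChart (h : IsCurveShorteningFlow I g τ γ) {t : ℝ} (ht : t ∈ timeInterval τ) (x : X) :
    IsCurveInChart I x (angular (γ · t)) (chartFamily I γ x) (1, 0) (fun b => (b, t))
      (chartDomain I τ γ x) where
  mdifferentiable := (h.immersed t ht).mdifferentiable_angular
  hasDerivAt b := (hasDerivAt_id b).prodMk (hasDerivAt_const b t)
  mem_source _ hb := hb.2
  eq_chart _ _ := rfl

variable [I.Boundaryless]

lemma isImmersedInChart (hg : IsSmoothMetric g) (x : X) :
    IsImmersedInChart (chartMetric I g x) (extChartAt I x).target (chartFamily I γ x) (1, 0)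
      (chartDomain I τ γ x) where
  metric := hg.isLocalMetric x
  isOpen := h.isOpen_chartDomain x
  smooth q hq := (h.contDiffWithinAt_chartFamily (mem_prod_timeInterval_of_mem_chartDomain hq)
    hq.2).mono fun _ => mem_prod_timeInterval_of_mem_chartDomain
  mapsTo q hq := (extChartAt I x).map_source hq.2
  immersed q hq := by
    have hS := mem_prod_timeInterval_of_mem_chartDomain hq
    rw [h.fderiv_chartFamily hq, h.chartFamilyDeriv_angle hS hq.2]
    exact chartDeriv_ne_zero hq.2 ((h.immersed _ hS.2).2 q.1)

lemma isChartFlow [FiniteDimensional ℝ E] (hg : IsSmoothMetric g) (x : X) :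
    IsChartFlow (chartMetric I g x) (extChartAt I x).target (chartFamily I γ x)
      (chartDomain I τ γ x) where
  toIsImmersedInChart := h.isImmersedInChart hg x
  evolution q hq := by
    have hS := mem_prod_timeInterval_of_mem_chartDomain hq
    rw [h.fderiv_chartFamily hq, h.chartFamilyDeriv_time hS hq.2]
    exact ((h.isCurveInChart hS.2 x).chartCurvature_eq (h.isImmersedInChart hg x) hg hq).symm

lemma form_chartTangent_eq (hg : IsSmoothMetric g) (hq : q ∈ chartDomain I τ γ x) :
    chartForm I θ x (chartFamily I γ x q)
        (chartTangent (chartMetric I g x) (chartFamily I γ x) (1, 0) q) =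
      formTangent I g θ (angular (γ · q.2)) q.1 :=
  (h.isCurveInChart (mem_prod_timeInterval_of_mem_chartDomain hq).2 x).form_chartTangent_eq
    (h.isImmersedInChart hg x) (a := q.1) hq

lemma chartCurvatureSq_eq [FiniteDimensional ℝ E] (hg : IsSmoothMetric g)
    (hq : q ∈ chartDomain I τ γ x) :
    chartCurvatureSq (chartMetric I g x) (chartFamily I γ x) (1, 0) q =
      curvatureSq I g (angular (γ · q.2)) q.1 :=
  (h.isCurveInChart (mem_prod_timeInterval_of_mem_chartDomain hq).2 x).chartCurvatureSq_eq
    (h.isImmersedInChart hg x) hg (a := q.1) hq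

omit [I.Boundaryless] in
lemma continuousWithinAt_chartFamilyDeriv (hq : q ∈ Set.univ ×ˢ timeInterval τ)
    (hx : γ (Circle.exp q.1) q.2 ∈ (extChartAt I x).source) :
    ContinuousWithinAt (chartFamilyDeriv I τ γ x) (Set.univ ×ˢ timeInterval τ) q :=
  ((h.contDiffWithinAt_chartFamily hq hx).fderivWithin_right (m := 0)
    (uniqueDiffOn_univ.prod (uniqueDiffOn_timeInterval τ)) (by simp) hq).continuousWithinAt

lemma continuousWithinAt_comp_chartFamily {F : Type*} [TopologicalSpace F] {Φ : E → F}
    (hΦ : ContinuousOn Φ (extChartAt I x).target) (hq : q ∈ Set.univ ×ˢ timeInterval τ)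
    (hx : γ (Circle.exp q.1) q.2 ∈ (extChartAt I x).source) :
    ContinuousWithinAt (fun q => Φ (chartFamily I γ x q)) (Set.univ ×ˢ timeInterval τ) q :=
  (hΦ.continuousAt (x := chartFamily I γ x q) ((isOpen_extChartAt_target x).mem_nhds
    ((extChartAt I x).map_source hx))).comp_continuousWithinAt
      (h.contDiffWithinAt_chartFamily hq hx).continuousWithinAt

lemma continuousWithinAt_chartMetric_chartFamilyDeriv (hg : IsSmoothMetric g)
    (hq : q ∈ Set.univ ×ˢ timeInterval τ) (hx : γ (Circle.exp q.1) q.2 ∈ (extChartAt I x).source)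
    (e : ℝ × ℝ) :
    ContinuousWithinAt (fun q => chartMetric I g x (chartFamily I γ x q)
        (chartFamilyDeriv I τ γ x q e) (chartFamilyDeriv I τ γ x q e))
      (Set.univ ×ˢ timeInterval τ) q := by
  have hderiv := (h.continuousWithinAt_chartFamilyDeriv hq hx).clm_apply
    (continuousWithinAt_const (b := e))
  exact ((h.continuousWithinAt_comp_chartFamily (hg.smooth x).continuousOn hq hx).clm_apply
    hderiv).clm_apply hderiv

lemma curvatureSq_eq_chartMetric (hq : q ∈ Set.univ ×ˢ timeInterval τ)
    (hx : γ (Circle.exp q.1) q.2 ∈ (extChartAt I x).source) :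
    curvatureSq I g (angular (γ · q.2)) q.1 = chartMetric I g x (chartFamily I γ x q)
      (chartFamilyDeriv I τ γ x q (0, 1)) (chartFamilyDeriv I τ γ x q (0, 1)) := by
  rw [h.chartFamilyDeriv_time hq hx, chartFamily, chartMetric_chartDeriv g hx, curvatureSq,
    angular]

lemma speed_eq_chartMetric (hq : q ∈ Set.univ ×ˢ timeInterval τ)
    (hx : γ (Circle.exp q.1) q.2 ∈ (extChartAt I x).source) :
    speed I g (angular (γ · q.2)) q.1 = √(chartMetric I g x (chartFamily I γ x q)
      (chartFamilyDeriv I τ γ x q (1, 0)) (chartFamilyDeriv I τ γ x q (1, 0))) := by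
  rw [h.chartFamilyDeriv_angle hq hx, chartFamily, chartMetric_chartDeriv g hx, speed_eq, angular]

lemma formTangent_eq_chartForm (hq : q ∈ Set.univ ×ˢ timeInterval τ)
    (hx : γ (Circle.exp q.1) q.2 ∈ (extChartAt I x).source) :
    formTangent I g θ (angular (γ · q.2)) q.1 = (speed I g (angular (γ · q.2)) q.1)⁻¹ *
      chartForm I θ x (chartFamily I γ x q) (chartFamilyDeriv I τ γ x q (1, 0)) := by
  rw [h.chartFamilyDeriv_angle hq hx, chartFamily, chartForm_chartDeriv hx, formTangent,
    modelTangent_eq, map_smul, smul_eq_mul, angular]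

lemma continuousOn_curvatureSq (hg : IsSmoothMetric g) :
    ContinuousOn (fun q : ℝ × ℝ => curvatureSq I g (angular (γ · q.2)) q.1)
      (Set.univ ×ˢ timeInterval τ) := by
  intro q hq
  have hx := mem_extChartAt_source (I := I) (γ (Circle.exp q.1) q.2)
  refine (h.continuousWithinAt_chartMetric_chartFamilyDeriv hg hq hx (0, 1)).congr_of_eventuallyEq
    ?_ (h.curvatureSq_eq_chartMetric hq hx)
  filter_upwards [h.eventually_mem_source hq, self_mem_nhdsWithin] with q' hx' hq'
  exact h.curvatureSq_eq_chartMetric hq' hx'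

lemma continuousOn_speed (hg : IsSmoothMetric g) :
    ContinuousOn (fun q : ℝ × ℝ => speed I g (angular (γ · q.2)) q.1)
      (Set.univ ×ˢ timeInterval τ) := by
  intro q hq
  have hx := mem_extChartAt_source (I := I) (γ (Circle.exp q.1) q.2)
  refine (h.continuousWithinAt_chartMetric_chartFamilyDeriv hg hq hx
    (1, 0)).sqrt.congr_of_eventuallyEq ?_ (h.speed_eq_chartMetric hq hx)
  filter_upwards [h.eventually_mem_source hq, self_mem_nhdsWithin] with q' hx' hq'
  exact h.speed_eq_chartMetric hq' hx'

lemma continuousOn_formTangent (hg : IsSmoothMetric g) (hθ : IsParallelForm I g θ) :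
    ContinuousOn (fun q : ℝ × ℝ => formTangent I g θ (angular (γ · q.2)) q.1)
      (Set.univ ×ˢ timeInterval τ) := by
  intro q hq
  have hx := mem_extChartAt_source (I := I) (γ (Circle.exp q.1) q.2)
  have hspeed : speed I g (angular (γ · q.2)) q.1 ≠ 0 :=
    (Real.sqrt_pos.2 (hg.pos _ _ ((h.immersed q.2 hq.2).2 q.1))).ne'
  have hform := (h.continuousWithinAt_comp_chartFamily (hθ _).smooth.continuousOn hq hx).clm_apply
    ((h.continuousWithinAt_chartFamilyDeriv hq hx).clm_apply
      (continuousWithinAt_const (b := ((1, 0) : ℝ × ℝ))))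
  refine (((h.continuousOn_speed hg q hq).inv₀ hspeed).mul hform).congr_of_eventuallyEq ?_
    (h.formTangent_eq_chartForm hq hx)
  filter_upwards [h.eventually_mem_source hq, self_mem_nhdsWithin] with q' hx' hq'
  exact h.formTangent_eq_chartForm hq' hx'

variable [FiniteDimensional ℝ E]

theorem formTangent_pos (hg : IsSmoothMetric g) (hθ : IsParallelForm I g θ)
    (hinit : ∀ a, 0 < formTangent I g θ (angular (γ · 0)) a) :
    ∀ t ∈ timeInterval τ, ∀ a, 0 < formTangent I g θ (angular (γ · t)) a := by
  intro t ht
  have himm := h.immersed 0 (Icc_subset_timeInterval ht ⟨le_rfl, ht.1⟩)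
  obtain ⟨δ, hδ, hlt⟩ := exists_pos_forall_lt_of_periodic
    (continuous_formTangent hg hθ himm.contMDiff_angular himm.2)
    (formTangent_periodic himm.mdifferentiable_angular (angular_periodic _))
    Real.two_pi_pos.ne' hinit
  have hneg := neg_of_no_first_zero (S := timeInterval τ)
    (w := fun a t => δ * Real.exp (-t) - formTangent I g θ (angular (γ · t)) a)
    (fun s hs => ⟨hs.1, Icc_subset_timeInterval hs⟩)
    (ContinuousOn.sub (by fun_prop) (h.continuousOn_formTangent hg hθ)) Real.two_pi_pos
    (fun s hs a => ?_) (fun a => by simpa using hlt a) (fun s hs hs0 a hzero hle => ?_)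
  · exact fun a => (by positivity : 0 < δ * Real.exp (-t)).trans (sub_neg.1 (hneg t ht a))
  · simp only [formTangent_periodic (h.immersed s hs).mdifferentiable_angular
      (angular_periodic _) a]
  · have hflow := h.isChartFlow hg (γ (Circle.exp a) s)
    have hq : (a, s) ∈ chartDomain I τ γ (γ (Circle.exp a) s) :=
      ⟨⟨hs0, hs.2⟩, mem_extChartAt_source _⟩
    refine hflow.not_isLocalMaxOn_exp_sub_form (hθ _) hq hδ ?_
      (isLocalMaxOn_of_forall_le_zero hflow.isOpen (fun q hq => hq.1.1.le) (fun q hq => ?_) hq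
        hzero hle)
    · rw [h.form_chartTangent_eq hg hq, hzero]
    · rw [h.form_chartTangent_eq hg hq]

theorem curvatureSq_lt (hg : IsSmoothMetric g) (hθ : IsParallelForm I g θ)
    (hpos : ∀ t ∈ timeInterval τ, ∀ a, 0 < formTangent I g θ (angular (γ · t)) a)
    {Ξ c : ℝ} (hΞ : SectionalCurvatureLE I g Ξ) (hc : Ξ < c) {B : ℝ} (hB : 0 < B)
    (hinit : ∀ a, curvatureSq I g (angular (γ · 0)) a <
      B * formTangent I g θ (angular (γ · 0)) a ^ 2) :
    ∀ t ∈ timeInterval τ, ∀ a, curvatureSq I g (angular (γ · t)) a <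
      B * Real.exp (2 * c * t) * formTangent I g θ (angular (γ · t)) a ^ 2 := by
  have hneg := neg_of_no_first_zero (S := timeInterval τ)
    (w := fun a t => curvatureSq I g (angular (γ · t)) a -
      B * Real.exp (2 * c * t) * formTangent I g θ (angular (γ · t)) a ^ 2)
    (fun s hs => ⟨hs.1, Icc_subset_timeInterval hs⟩)
    ((h.continuousOn_curvatureSq hg).sub
      (ContinuousOn.mul (by fun_prop) ((h.continuousOn_formTangent hg hθ).pow 2)))
    Real.two_pi_pos (fun s hs a => ?_) (fun a => by simpa using hinit a)
    (fun s hs hs0 a hzero hle => ?_)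
  · exact fun t ht a => sub_neg.1 (hneg t ht a)
  · simp only [formTangent_periodic (h.immersed s hs).mdifferentiable_angular
      (angular_periodic _) a, curvatureSq_periodic (h.immersed s hs).mdifferentiable_angular
      (angular_periodic _) a]
  · have hflow := h.isChartFlow hg (γ (Circle.exp a) s)
    have hq : (a, s) ∈ chartDomain I τ γ (γ (Circle.exp a) s) :=
      ⟨⟨hs0, hs.2⟩, mem_extChartAt_source _⟩
    have hsec : LocalSectionalCurvatureLE (chartMetric I g (γ (Circle.exp a) s))
        (chartFamily I γ (γ (Circle.exp a) s) (a, s)) Ξ := hΞ.localSectionalCurvatureLE _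
    refine hflow.not_isLocalMaxOn_curvatureSq_sub (hθ _) hsec hc hq hB ?_ ?_
      (isLocalMaxOn_of_forall_le_zero hflow.isOpen (fun q hq => hq.1.1.le) (fun q hq => ?_) hq
        hzero hle)
    · rw [h.form_chartTangent_eq hg hq]
      exact hpos s hs a
    · rw [h.form_chartTangent_eq hg hq, h.chartCurvatureSq_eq hg hq, ← sq, hzero]
    · rw [h.form_chartTangent_eq hg hq, h.chartCurvatureSq_eq hg hq, ← sq]

theorem curvatureSq_le (hg : IsSmoothMetric g) (hθ : IsParallelForm I g θ)
    (hpos : ∀ t ∈ timeInterval τ, ∀ a, 0 < formTangent I g θ (angular (γ · t)) a)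
    {Ξ : ℝ} (hΞ : SectionalCurvatureLE I g Ξ) {B : ℝ} (hB : 0 < B)
    (hinit : ∀ a, curvatureSq I g (angular (γ · 0)) a <
      B * formTangent I g θ (angular (γ · 0)) a ^ 2) {t : ℝ} (ht : t ∈ timeInterval τ) (a : ℝ) :
    curvatureSq I g (angular (γ · t)) a ≤
      B * Real.exp (2 * Ξ * t) * formTangent I g θ (angular (γ · t)) a ^ 2 := by
  have hcont : Continuous fun c =>
      B * Real.exp (2 * c * t) * formTangent I g θ (angular (γ · t)) a ^ 2 := by fun_prop
  refine ge_of_tendsto (x := nhdsWithin Ξ (Set.Ioi Ξ))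
    ((hcont.tendsto Ξ).mono_left nhdsWithin_le_nhds) ?_
  filter_upwards [self_mem_nhdsWithin] with c hc
  exact (h.curvatureSq_lt hg hθ hpos hΞ hc hB hinit t ht a).le

end IsCurveShorteningFlow

end ManifoldFlow

lemma IsParallelForm.const_smul {E : Type*} [NormedAddCommGroup E] [NormedSpace ℝ E]
    {H : Type*} [TopologicalSpace H] {I : ModelWithCorners ℝ E H}
    {X : Type*} [TopologicalSpace X] [ChartedSpace H X]
    {g : ∀ x : X, TangentSpace I x →L[ℝ] TangentSpace I x →L[ℝ] ℝ} {θ : X → E →L[ℝ] ℝ}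
    (hθ : IsParallelForm I g θ) (r : ℝ) : IsParallelForm I g (fun p => r • θ p) :=
  fun x => (hθ x).const_smul r

/-! ### The angular form of the circle -/

section CircleForm

open ComplexConjugate

/-- The derivative of the inclusion of the unit circle into `ℂ`. -/
def circleCoeDeriv (z : Circle) : EuclideanSpace ℝ (Fin 1) →L[ℝ] ℂ :=
  mfderiv (𝓡 1) 𝓘(ℝ, ℂ) (fun z' : Circle => (z' : ℂ)) z

/-- The angular form `dσ` of the unit circle. At `z` a tangent vector is a purely imaginary
multiple of `z`, so `dσ` is the imaginary part of the quotient by `z`. -/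
def circleForm (z : Circle) : EuclideanSpace ℝ (Fin 1) →L[ℝ] ℝ :=
  Complex.imCLM.comp ((ContinuousLinearMap.mul ℝ ℂ (conj (z : ℂ))).comp (circleCoeDeriv z))

lemma circleForm_apply (z : Circle) (v : EuclideanSpace ℝ (Fin 1)) :
    circleForm z v = (conj (z : ℂ) * circleCoeDeriv z v).im := rfl

lemma contMDiff_circle_coe : ContMDiff (𝓡 1) 𝓘(ℝ, ℂ) ∞ (fun z : Circle => (z : ℂ)) :=
  have := finrank_real_complex_fact'
  contMDiff_coe_sphere

lemma circleCoeDeriv_injective (z : Circle) : Function.Injective (circleCoeDeriv z) :=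
  have := finrank_real_complex_fact'
  injective_mvfderiv_subtypeVal_sphere (n := 1) (E := ℂ) z

lemma re_conj_mul_circleCoeDeriv (z : Circle) (v : EuclideanSpace ℝ (Fin 1)) :
    (conj (z : ℂ) * circleCoeDeriv z v).re = 0 := by
  have := finrank_real_complex_fact'
  have hmem : circleCoeDeriv z v ∈ (Submodule.span ℝ {(z : ℂ)})ᗮ := by
    rw [← range_mvfderiv_subtypeVal (n := 1) (E := ℂ) z]
    exact ⟨v, rfl⟩
  have hinner := Submodule.mem_orthogonal_singleton_iff_inner_right.1 hmem
  rwa [Complex.inner, mul_comm] at hinner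

lemma metricAt_circleMetric (z : Circle) (v w : EuclideanSpace ℝ (Fin 1)) :
    metricAt (𝓡 1) circleMetric z v w = circleForm z v * circleForm z w := by
  have hz : (z : ℂ) * conj (z : ℂ) = 1 := by
    rw [Complex.mul_conj, Circle.normSq_coe, Complex.ofReal_one]
  calc
    metricAt (𝓡 1) circleMetric z v w
      = (conj (circleCoeDeriv z v) * circleCoeDeriv z w).re := by
        rw [mul_comm, ← Complex.inner]
        rfl
    _ = (conj (conj (z : ℂ) * circleCoeDeriv z v) * (conj (z : ℂ) * circleCoeDeriv z w)).re := by
        congr 1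
        simp only [map_mul, Complex.conj_conj]
        linear_combination -(conj (circleCoeDeriv z v) * circleCoeDeriv z w) * hz
    _ = circleForm z v * circleForm z w := by
        rw [Complex.mul_re, Complex.conj_re, Complex.conj_im, re_conj_mul_circleCoeDeriv,
          circleForm_apply, circleForm_apply]
        ring

lemma circleForm_ne_zero (z : Circle) {v : EuclideanSpace ℝ (Fin 1)} (hv : v ≠ 0) :
    circleForm z v ≠ 0 := by
  intro h
  have hmul : conj (z : ℂ) * circleCoeDeriv z v = 0 :=
    Complex.ext (re_conj_mul_circleCoeDeriv z v) h
  have hzero : circleCoeDeriv z v = 0 := (mul_eq_zero.1 hmul).resolve_left (by simp)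
  exact hv (circleCoeDeriv_injective z (by rw [hzero, map_zero]))

/-- The inclusion of the circle into `ℂ` in the preferred chart around `x`. -/
def circleChartCoe (x : Circle) (y : EuclideanSpace ℝ (Fin 1)) : ℂ :=
  ((extChartAt (𝓡 1) x).symm y : Circle)

lemma contDiffOn_circleChartCoe (x : Circle) :
    ContDiffOn ℝ ∞ (circleChartCoe x) (extChartAt (𝓡 1) x).target :=
  (contMDiff_circle_coe.comp_contMDiffOn (contMDiffOn_extChartAt_symm x)).contDiffOn

variable {x : Circle} {y : EuclideanSpace ℝ (Fin 1)}

lemma fderiv_circleChartCoe (hy : y ∈ (extChartAt (𝓡 1) x).target)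
    (v : EuclideanSpace ℝ (Fin 1)) :
    fderiv ℝ (circleChartCoe x) y v =
      circleCoeDeriv ((extChartAt (𝓡 1) x).symm y) (chartSymmDeriv (𝓡 1) x y v) := by
  have h := mfderiv_comp (I := 𝓘(ℝ, EuclideanSpace ℝ (Fin 1))) (I' := 𝓡 1) (I'' := 𝓘(ℝ, ℂ)) y
    ((contMDiff_circle_coe _).mdifferentiableAt (by simp)) (mdifferentiableAt_extChartAt_symm hy)
  rw [mfderiv_eq_fderiv] at h
  exact DFunLike.congr_fun h v

lemma chartForm_circleForm (hy : y ∈ (extChartAt (𝓡 1) x).target) :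
    chartForm (𝓡 1) circleForm x y = Complex.imCLM.comp
      ((ContinuousLinearMap.mul ℝ ℂ (conj (circleChartCoe x y))).comp
        (fderiv ℝ (circleChartCoe x) y)) := by
  ext v
  simp only [ContinuousLinearMap.comp_apply, fderiv_circleChartCoe hy]
  rfl

lemma contDiffAt_chartForm_circleForm (hy : y ∈ (extChartAt (𝓡 1) x).target) :
    ContDiffAt ℝ ∞ (chartForm (𝓡 1) circleForm x) y := by
  have hopen := isOpen_extChartAt_target (I := 𝓡 1) x
  have hcoe := (contDiffOn_circleChartCoe x).contDiffAt (hopen.mem_nhds hy)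
  have hconj := (ContinuousLinearMap.mul ℝ ℂ).contDiff.comp_contDiffAt y
    (Complex.conjCLE.contDiff.comp_contDiffAt y hcoe)
  have hform := (contDiffAt_const (c := Complex.imCLM)).clm_comp
    (hconj.clm_comp (hcoe.fderiv_right (m := ∞) (by simp)))
  exact hform.congr_of_eventuallyEq
    (Filter.eventually_of_mem (hopen.mem_nhds hy) fun y hy => chartForm_circleForm hy)

lemma chartForm_circleForm_ne_zero (hy : y ∈ (extChartAt (𝓡 1) x).target) :
    chartForm (𝓡 1) circleForm x y ≠ 0 := by
  intro h
  obtain ⟨v, hv⟩ := exists_ne (0 : EuclideanSpace ℝ (Fin 1))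
  have hsymm : chartSymmDeriv (𝓡 1) x y v ≠ 0 := fun hzero =>
    hv (by rw [← chartDeriv_chartSymmDeriv hy v, hzero, map_zero])
  exact circleForm_ne_zero _ hsymm (DFunLike.congr_fun h v)

lemma apply_comm_of_fin_one (B : EuclideanSpace ℝ (Fin 1) →L[ℝ] EuclideanSpace ℝ (Fin 1) →L[ℝ] ℝ)
    (v w : EuclideanSpace ℝ (Fin 1)) : B v w = B w v := by
  have hspan (u : EuclideanSpace ℝ (Fin 1)) : u = u 0 • EuclideanSpace.single 0 1 := by
    ext i
    fin_cases i
    simp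
  rw [hspan v, hspan w]
  simp only [map_smul, smul_apply, smul_comm (v 0)]

end CircleForm

/-! ### The product with the circle -/

section Product

variable {n : ℕ} {M : Type*} [TopologicalSpace M] [ChartedSpace (EuclideanSpace ℝ (Fin n)) M]

/-- The pullback of the angular form to `M × S¹`. -/
def productForm (p : M × Circle) :
    EuclideanSpace ℝ (Fin n) × EuclideanSpace ℝ (Fin 1) →L[ℝ] ℝ :=
  (circleForm p.2).comp (ContinuousLinearMap.snd ℝ _ _)

variable {g : ∀ x : M, TangentSpace (𝓡 n) x →L[ℝ] TangentSpace (𝓡 n) x →L[ℝ] ℝ} {p : M × Circle}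
  {y : EuclideanSpace ℝ (Fin n) × EuclideanSpace ℝ (Fin 1)}

lemma metricAt_productMetric (v w : EuclideanSpace ℝ (Fin n) × EuclideanSpace ℝ (Fin 1)) :
    metricAt ((𝓡 n).prod (𝓡 1)) (productMetric g) p v w =
      metricAt (𝓡 n) g p.1 v.1 w.1 + productForm p v * productForm p w := by
  have hcircle := metricAt_circleMetric p.2 v.2 w.2
  have hfst := mfderiv_fst (I := 𝓡 n) (I' := 𝓡 1) (x := p)
  have hsnd := mfderiv_snd (I := 𝓡 n) (I' := 𝓡 1) (x := p)
  simp only [productForm, ContinuousLinearMap.comp_apply, ContinuousLinearMap.coe_snd']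
  rw [← hcircle]
  simp only [metricAt, productMetric, hfst, hsnd]
  rfl

lemma mem_target_of_mem_target_prod (hy : y ∈ (extChartAt ((𝓡 n).prod (𝓡 1)) p).target) :
    y.1 ∈ (extChartAt (𝓡 n) p.1).target ∧ y.2 ∈ (extChartAt (𝓡 1) p.2).target := by
  rw [extChartAt_prod, PartialEquiv.prod_target] at hy
  exact hy

lemma extChartAt_prod_symm_apply (p : M × Circle)
    (y : EuclideanSpace ℝ (Fin n) × EuclideanSpace ℝ (Fin 1)) :
    (extChartAt ((𝓡 n).prod (𝓡 1)) p).symm y =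
      ((extChartAt (𝓡 n) p.1).symm y.1, (extChartAt (𝓡 1) p.2).symm y.2) := by
  rw [extChartAt_prod]
  rfl

variable [IsManifold (𝓡 n) ∞ M]

lemma chartSymmDeriv_prod (hy : y ∈ (extChartAt ((𝓡 n).prod (𝓡 1)) p).target)
    (v : EuclideanSpace ℝ (Fin n) × EuclideanSpace ℝ (Fin 1)) :
    chartSymmDeriv ((𝓡 n).prod (𝓡 1)) p y v =
      (chartSymmDeriv (𝓡 n) p.1 y.1 v.1, chartSymmDeriv (𝓡 1) p.2 y.2 v.2) := by
  have hy' := mem_target_of_mem_target_prod hy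
  have hM := (mdifferentiableAt_extChartAt_symm hy'.1).hasMFDerivAt
  have hS := (mdifferentiableAt_extChartAt_symm hy'.2).hasMFDerivAt
  have hprod := (hM.comp y hasFDerivAt_fst.hasMFDerivAt).prodMk
    (hS.comp y hasFDerivAt_snd.hasMFDerivAt)
  have hsymm := hprod.congr_of_eventuallyEq
    (Filter.Eventually.of_forall (extChartAt_prod_symm_apply p))
  exact DFunLike.congr_fun hsymm.mfderiv v

lemma chartForm_productForm (hy : y ∈ (extChartAt ((𝓡 n).prod (𝓡 1)) p).target) :
    chartForm ((𝓡 n).prod (𝓡 1)) productForm p y =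
      (chartForm (𝓡 1) circleForm p.2 y.2).comp (ContinuousLinearMap.snd ℝ _ _) := by
  refine ContinuousLinearMap.ext fun v => ?_
  simp only [chartForm, productForm, ContinuousLinearMap.comp_apply, chartSymmDeriv_prod hy,
    extChartAt_prod_symm_apply, ContinuousLinearMap.coe_snd']

lemma chartMetric_productMetric (hy : y ∈ (extChartAt ((𝓡 n).prod (𝓡 1)) p).target)
    (v w : EuclideanSpace ℝ (Fin n) × EuclideanSpace ℝ (Fin 1)) :
    chartMetric ((𝓡 n).prod (𝓡 1)) (productMetric g) p y v w =
      chartMetric (𝓡 n) g p.1 y.1 v.1 w.1 +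
        chartForm (𝓡 1) circleForm p.2 y.2 v.2 * chartForm (𝓡 1) circleForm p.2 y.2 w.2 := by
  rw [chartMetric_apply, metricAt_productMetric, chartSymmDeriv_prod hy, chartSymmDeriv_prod hy,
    extChartAt_prod_symm_apply, chartMetric_apply]
  rfl

namespace IsSmoothMetric

variable (hg : IsSmoothMetric g)
include hg

omit [IsManifold (𝓡 n) ∞ M] in
lemma productForm_sq_le (p : M × Circle)
    (v : EuclideanSpace ℝ (Fin n) × EuclideanSpace ℝ (Fin 1)) :
    productForm p v ^ 2 ≤ metricAt ((𝓡 n).prod (𝓡 1)) (productMetric g) p v v := by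
  rw [metricAt_productMetric, sq]
  exact le_add_of_nonneg_left (hg.metricAt_self_nonneg p.1 v.1)

omit [IsManifold (𝓡 n) ∞ M] in
lemma metricAt_productMetric_pos (p : M × Circle)
    {v : EuclideanSpace ℝ (Fin n) × EuclideanSpace ℝ (Fin 1)} (hv : v ≠ 0) :
    0 < metricAt ((𝓡 n).prod (𝓡 1)) (productMetric g) p v v := by
  by_cases hv₂ : v.2 = 0
  · have hv₁ : v.1 ≠ 0 := fun hv₁ => hv (Prod.ext hv₁ hv₂)
    rw [metricAt_productMetric]
    exact add_pos_of_pos_of_nonneg (hg.pos p.1 v.1 hv₁) (mul_self_nonneg _)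
  · exact (sq_pos_of_ne_zero (circleForm_ne_zero p.2 hv₂)).trans_le (hg.productForm_sq_le p v)

lemma contDiffOn_chartMetric_productMetric (p : M × Circle) :
    ContDiffOn ℝ ∞ (chartMetric ((𝓡 n).prod (𝓡 1)) (productMetric g) p)
      (extChartAt ((𝓡 n).prod (𝓡 1)) p).target := by
  refine contDiffOn_clm_apply.2 fun v => contDiffOn_clm_apply.2 fun w => ?_
  have hM : ContDiffOn ℝ ∞ (fun y : EuclideanSpace ℝ (Fin n) × EuclideanSpace ℝ (Fin 1) =>
      chartMetric (𝓡 n) g p.1 y.1 v.1 w.1) (extChartAt ((𝓡 n).prod (𝓡 1)) p).target :=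
    (((hg.smooth p.1).comp contDiff_fst.contDiffOn fun y hy =>
      (mem_target_of_mem_target_prod hy).1).clm_apply contDiffOn_const).clm_apply contDiffOn_const
  have hS (u : EuclideanSpace ℝ (Fin 1)) : ContDiffOn ℝ ∞
      (fun y : EuclideanSpace ℝ (Fin n) × EuclideanSpace ℝ (Fin 1) =>
        chartForm (𝓡 1) circleForm p.2 y.2 u) (extChartAt ((𝓡 n).prod (𝓡 1)) p).target :=
    fun y hy => ((((contDiffAt_chartForm_circleForm (mem_target_of_mem_target_prod hy).2).comp y
      contDiffAt_snd).clm_apply contDiffAt_const)).contDiffWithinAt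
  exact (hM.add ((hS v.2).mul (hS w.2))).congr fun y hy => chartMetric_productMetric hy v w

lemma productMetric : IsSmoothMetric (I := (𝓡 n).prod (𝓡 1)) (productMetric g) where
  symm p v w := by
    rw [metricAt_productMetric, metricAt_productMetric, hg.symm, mul_comm]
  pos p _ := hg.metricAt_productMetric_pos p
  smooth := hg.contDiffOn_chartMetric_productMetric

lemma isParallelForm_productForm :
    IsParallelForm ((𝓡 n).prod (𝓡 1)) (_root_.productMetric g) (productForm (M := M)) := by
  intro p
  have hmem {y} (hy : y ∈ (extChartAt ((𝓡 n).prod (𝓡 1)) p).target) :=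
    mem_target_of_mem_target_prod hy
  refine IsLocalParallelForm.congr ?_ (isOpen_extChartAt_target p) fun y hy =>
    chartForm_productForm hy
  refine (hg.productMetric.isLocalMetric p).isLocalParallelForm_of_splitting
    (G₁ := chartMetric (𝓡 n) g p.1) (η := chartForm (𝓡 1) circleForm p.2)
    (fun y hy => (hg.isLocalMetric p.1).differentiableAt (hmem hy).1)
    (fun y hy => contDiffAt_chartForm_circleForm (hmem hy).2)
    (fun y _ => apply_comm_of_fin_one _)
    (fun y hy => chartForm_circleForm_ne_zero (hmem hy).2)
    fun y hy => chartMetric_productMetric hy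

end IsSmoothMetric

end Product

/-! ### Ramps -/

section Ramps

open ComplexConjugate

variable {U : ∀ z : Circle, TangentSpace (𝓡 1) z}

lemma continuous_circleForm_section
    (hU : ContMDiff (𝓡 1) (𝓡 1).tangent ∞ (fun z => (⟨z, U z⟩ : TangentBundle (𝓡 1) Circle))) :
    Continuous (fun z => circleForm z (U z)) := by
  have hmap : Continuous (tangentMap (𝓡 1) 𝓘(ℝ, ℂ) (fun z : Circle => (z : ℂ))) :=
    contMDiff_circle_coe.continuous_tangentMap (by simp)
  have hderiv : Continuous (fun z => circleCoeDeriv z (U z)) :=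
    (contMDiff_snd_tangentBundle_modelSpace (n := ∞) ℂ 𝓘(ℝ, ℂ)).continuous.comp
      (hmap.comp hU.continuous)
  have hconj : Continuous (fun z : Circle => conj (z : ℂ)) :=
    Complex.continuous_conj.comp contMDiff_circle_coe.continuous
  exact Complex.continuous_im.comp (hconj.mul hderiv)

lemma exists_circleForm_eq
    (hU : ContMDiff (𝓡 1) (𝓡 1).tangent ∞ (fun z => (⟨z, U z⟩ : TangentBundle (𝓡 1) Circle)))
    (hunit : ∀ z, circleMetric z (U z) (U z) = 1) :
    ∃ r : ℝ, r ^ 2 = 1 ∧ ∀ z, circleForm z (U z) = r := by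
  have hsq (z : Circle) : circleForm z (U z) ^ 2 = 1 :=
    (sq _).trans ((metricAt_circleMetric z (U z) (U z)).symm.trans (hunit z))
  have hconn : IsPreconnected (Set.univ : Set Circle) := by
    rw [← Circle.exp_surjective.range_eq]
    exact isPreconnected_range Circle.exp.continuous
  have heq := hconn.eq_of_sq_eq (continuous_circleForm_section hU).continuousOn
    (continuousOn_const (c := circleForm 1 (U 1)))
    (fun z _ => (hsq z).trans (hsq 1).symm)
    (fun _ hzero => by simpa only [hzero, zero_pow two_ne_zero, zero_ne_one] using hsq 1)
    (Set.mem_univ 1) rfl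
  exact ⟨circleForm 1 (U 1), hsq 1, fun z => heq (Set.mem_univ z)⟩

variable {n : ℕ} {M : Type*} [TopologicalSpace M] [ChartedSpace (EuclideanSpace ℝ (Fin n)) M]

lemma circleMetric_mfderiv_snd (p : M × Circle)
    (v : EuclideanSpace ℝ (Fin n) × EuclideanSpace ℝ (Fin 1)) (u : EuclideanSpace ℝ (Fin 1)) :
    circleMetric p.2 (mfderiv ((𝓡 n).prod (𝓡 1)) (𝓡 1) (Prod.snd : M × Circle → Circle) p v) u =
      productForm p v * circleForm p.2 u := by
  rw [mfderiv_snd]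
  exact metricAt_circleMetric p.2 v.2 u

lemma circleMetric_snd_unitTangent
    {g : ∀ x : M, TangentSpace (𝓡 n) x →L[ℝ] TangentSpace (𝓡 n) x →L[ℝ] ℝ}
    {r : ℝ} (hr : ∀ z, circleForm z (U z) = r) (c : ℝ → M × Circle) (a : ℝ) :
    circleMetric (c a).2 (mfderiv ((𝓡 n).prod (𝓡 1)) (𝓡 1) (Prod.snd : M × Circle → Circle) (c a)
        (unitTangent ((𝓡 n).prod (𝓡 1)) (productMetric g) c a)) (U (c a).2) =
      formTangent ((𝓡 n).prod (𝓡 1)) (productMetric g) (fun p => r • productForm p) c a := by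
  have h := circleMetric_mfderiv_snd (c a)
    (modelTangent ((𝓡 n).prod (𝓡 1)) (productMetric g) c a) (U (c a).2)
  rw [hr, mul_comm] at h
  exact h

variable [IsManifold (𝓡 n) ∞ M]

lemma IsRamp.exists_isParallelForm
    {g : ∀ x : M, TangentSpace (𝓡 n) x →L[ℝ] TangentSpace (𝓡 n) x →L[ℝ] ℝ}
    (hg : IsSmoothMetric (I := 𝓡 n) g) {γ₀ : Circle → M × Circle} (hramp : IsRamp g γ₀) :
    ∃ θ : M × Circle → EuclideanSpace ℝ (Fin n) × EuclideanSpace ℝ (Fin 1) →L[ℝ] ℝ,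
      IsParallelForm ((𝓡 n).prod (𝓡 1)) (productMetric g) θ ∧
      (∀ p v, θ p v ^ 2 ≤ metricAt ((𝓡 n).prod (𝓡 1)) (productMetric g) p v v) ∧
      (∀ a, 0 < formTangent ((𝓡 n).prod (𝓡 1)) (productMetric g) θ (angular γ₀) a) ∧
      ∀ γ : Circle → M × Circle,
        (∀ a, 0 < formTangent ((𝓡 n).prod (𝓡 1)) (productMetric g) θ (angular γ) a) →
          IsRamp g γ := by
  obtain ⟨U, hU, hunit, hpos⟩ := hramp
  obtain ⟨r, hr, hUr⟩ := exists_circleForm_eq hU hunit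
  have hinner (γ : Circle → M × Circle) := circleMetric_snd_unitTangent (g := g) hUr (angular γ)
  refine ⟨fun p => r • productForm p, hg.isParallelForm_productForm.const_smul r, fun p v => ?_,
    fun a => (hinner γ₀ a) ▸ hpos a,
    fun γ hγ => ⟨U, hU, hunit, fun a => (hinner γ a).symm ▸ hγ a⟩⟩
  rw [smul_apply, smul_eq_mul, mul_pow, hr, one_mul]
  exact hg.productForm_sq_le p v

theorem proposition18_general (g : Bundle.ContMDiffRiemannianMetric (𝓡 n) ∞
      (EuclideanSpace ℝ (Fin n)) (fun x : M => TangentSpace (𝓡 n) x))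
    (γ₀ : Circle → M × Circle) (hγ₀ : IsImmersedCurve ((𝓡 n).prod (𝓡 1)) γ₀)
    (hramp : IsRamp g.inner γ₀) :
    ∃ C > 0, ∀ Ξ, SectionalCurvatureLE ((𝓡 n).prod (𝓡 1)) (productMetric g.inner) Ξ →
      ∀ τ γ, IsCurveShorteningFlow ((𝓡 n).prod (𝓡 1)) (productMetric g.inner) τ γ →
        (∀ z, γ z 0 = γ₀ z) → ∀ t ∈ timeInterval τ, IsRamp g.inner (γ · t) ∧
          ∀ k, IsSignedCurvature ((𝓡 n).prod (𝓡 1)) (productMetric g.inner) (γ · t) k →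
            ∀ z, |k z| ≤ C * Real.exp (Ξ * t) := by
  have hM := isSmoothMetric_inner g
  have hg := hM.productMetric
  obtain ⟨θ, hθ, hle, hpos₀, hrampOf⟩ := hramp.exists_isParallelForm hM
  obtain ⟨B, hB, hB₀⟩ := hγ₀.exists_curvatureSq_lt_mul_formTangent_sq hg hθ hpos₀
  refine ⟨√B, Real.sqrt_pos.2 hB, fun Ξ hΞ τ γ hγ hstart t ht => ?_⟩
  obtain rfl : (γ · 0) = γ₀ := funext hstart
  have hpos := hγ.formTangent_pos hg hθ hpos₀
  refine ⟨hrampOf _ (hpos t ht), fun k hk z => ?_⟩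
  obtain ⟨a, rfl⟩ := Circle.exp_surjective z
  refine abs_le_of_sq_le_sq ?_ (by positivity)
  calc k (Circle.exp a) ^ 2
      = curvatureSq ((𝓡 n).prod (𝓡 1)) (productMetric g.inner) (angular (γ · t)) a := hk.sq_eq a
    _ ≤ B * Real.exp (2 * Ξ * t) *
          formTangent _ (productMetric g.inner) θ (angular (γ · t)) a ^ 2 :=
      hγ.curvatureSq_le hg hθ hpos hΞ hB hB₀ ht a
    _ ≤ B * Real.exp (2 * Ξ * t) :=
      mul_le_of_le_one_right (by positivity)
        (hg.formTangent_sq_le_one hle ((hγ.immersed t ht).2 a))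
    _ = (√B * Real.exp (Ξ * t)) ^ 2 := by
      rw [mul_pow, Real.sq_sqrt hB.le, ← Real.exp_nat_mul, Nat.cast_ofNat, mul_assoc]

end Ramps

end

theorem proposition18 {n : ℕ} {M : Type*} [TopologicalSpace M] [T2Space M]
    [SecondCountableTopology M] [ChartedSpace (EuclideanSpace ℝ (Fin n)) M] [IsManifold (𝓡 n) ∞ M]
    (g : Bundle.ContMDiffRiemannianMetric (𝓡 n) ∞ (EuclideanSpace ℝ (Fin n))
      (fun x : M => TangentSpace (𝓡 n) x))
    (γ₀ : Circle → M × Circle)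
    (hγ₀ : IsImmersedCurve ((𝓡 n).prod (𝓡 1)) γ₀)
    (hramp : IsRamp g.inner γ₀) :
    ∃ C₁ < (0 : ℝ), ∃ C₂ > (0 : ℝ),
      ∀ Ξ > (0 : ℝ), SectionalCurvatureLE ((𝓡 n).prod (𝓡 1)) (productMetric g.inner) Ξ →
      ∀ τ > (0 : EReal), ∀ γ : Circle → ℝ → M × Circle,
        IsCurveShorteningFlow ((𝓡 n).prod (𝓡 1)) (productMetric g.inner) τ γ →
        (∀ z, γ z 0 = γ₀ z) →
        (∀ t ∈ timeInterval τ, IsRamp g.inner (fun z => γ z t)) ∧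
        ∀ k : Circle → ℝ → ℝ,
          (∀ t ∈ timeInterval τ, IsSignedCurvature ((𝓡 n).prod (𝓡 1)) (productMetric g.inner)
            (fun z => γ z t) (fun z => k z t)) →
          ((∀ t ∈ timeInterval τ, (⨅ z, k z t) < 0) →
            ∀ t ∈ timeInterval τ, ∀ z, C₁ * Real.exp (Ξ * t) ≤ k z t) ∧
          ((∀ t ∈ timeInterval τ, 0 < (⨆ z, k z t)) →
            ∀ t ∈ timeInterval τ, ∀ z, k z t ≤ C₂ * Real.exp (Ξ * t)) := by
  obtain ⟨C, hC, h⟩ := proposition18_general g γ₀ hγ₀ hramp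
  refine ⟨-C, neg_lt_zero.2 hC, C, hC, fun Ξ _ hΞ τ _ γ hγ hstart =>
    ⟨fun t ht => (h Ξ hΞ τ γ hγ hstart t ht).1, fun k hk => ?_⟩⟩
  have habs (t) (ht : t ∈ timeInterval τ) (z) : |k z t| ≤ C * Real.exp (Ξ * t) :=
    (h Ξ hΞ τ γ hγ hstart t ht).2 _ (hk t ht) z
  exact ⟨fun _ t ht z => (neg_mul C _).trans_le (abs_le.1 (habs t ht z)).1,
    fun _ t ht z => (abs_le.1 (habs t ht z)).2⟩
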